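/- For $\bar\gamma>0$, $m>1/2$, $m_s>1$ let $\mathcal F(\bar\gamma;m;m_s)$ (the squared Fisher–Snedecor law) be the probability law on $(0,\infty)$ with density $$f_\gamma(x)=\frac{m^m(m_s-1)^{m_s}\bar\gamma^{m_s}x^{m-1}}{B(m,m_s)\,(mx+(m_s-1)\bar\gamma)^{m+m_s}},\qquad x>0,$$ where $B(\cdot,\cdot)$ is the Beta function. For $p,q\ge0$, $0\le m\le q$, $0\le n\le p$ let $$G^{m,n}_{p,q}\!\left(x\,\middle|\,{a_1,\dots,a_p\atop b_1,\dots,b_q}\right)=\frac1{2\pi i}\int_{\mathcal L}\frac{\prod_{j=1}^m\Gamma(b_j-s)\prod_{k=1}^n\Gamma(1-a_k+s)}{\prod_{j=m+1}^q\Gamma(1-b_j+s)\prod_{k=n+1}^p\Gamma(a_k-s)}\,x^s\,ds$$ denote Meijer's $G$-function (with the principal branch of $x^s$), where $\mathcal L$ runs from $c-i\infty$ to $c+i\infty$ along a vertical line that has the poles of $\Gamma(b_j-s)$, $1\le j\le m$, on its right and the poles of $\Gamma(1-a_k+s)$, $1\le k\le n$, on its left. Let $L_1,L_2\ge 0$ be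 integers with $L_1+L_2\ge1$, and for $i\in\{1,2\}$, $1\le\ell\le L_i$, let $\gamma_{i,\ell}\sim\mathcal F(\bar\gamma_{i,\ell};m_{i,\ell};m_{i,s_\ell})$ with $\bar\gamma_{i,\ell}>0$, $m_{i,\ell}>1/2$, $m_{i,s_\ell}>1$; let all these $L_1+L_2$ random variables be independent (not necessarily identically distributed). Put $Z=\prod_{\ell=1}^{L_1}\gamma_{1,\ell}\big/\prod_{\ell=1}^{L_2}\gamma_{2,\ell}$ and, for $i\in\{1,2\}$, $$A_i=\prod_{\ell=1}^{L_i}\frac{m_{i,\ell}}{m_{i,s_\ell}-1},\quad B_i=\prod_{\ell=1}^{L_i}\Gamma(m_{i,\ell})\Gamma(m_{i,s_\ell}),\quad \bar\gamma_i=\prod_{\ell=1}^{L_i}\bar\gamma_{i,\ell},\quad \Delta_i=\{m_{i,\ell}\}_{\ell=1}^{L_i},\quad E_i=\{m_{i,s_\ell}\}_{\ell=1}^{L_i},$$ with empty products equal to $1$. Then $Z$ has a probability density $f_Z$, zero on $(-\infty,0]$, and its density $f_Z(z)$ and distribution function $F_Z(z)$ at every $z>0$, and its moment generating function $\mathcal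 M_Z(s)=\mathbb E[e^{-sZ}]$ at every complex $s$ with $\operatorname{Re}s>0$ (in particular at every real $s>0$), are given by $$f_Z(z)=\frac1{zB_1B_2}\,G^{L_1+L_2,\,L_1+L_2}_{L_1+L_2,\,L_1+L_2}\!\left(\frac{\bar\gamma_1A_2}{z\bar\gamma_2A_1}\,\middle|\,{1-\Delta_1,\,1-E_2\atop \Delta_2,\,E_1}\right),$$ $$F_Z(z)=\frac1{B_1B_2}\,G^{L_1+L_2+1,\,L_1+L_2}_{L_1+L_2+1,\,L_1+L_2+1}\!\left(\frac{\bar\gamma_1A_2}{z\bar\gamma_2A_1}\,\middle|\,{1-\Delta_1,\,1-E_2,\,1\atop \Delta_2,\,E_1,\,0}\right),$$ $$\mathcal M_Z(s)=\frac1{B_1B_2}\,G^{L_1+L_2,\,L_1+L_2+1}_{L_1+L_2+1,\,L_1+L_2}\!\left(\frac{\bar\gamma_2A_1}{s\bar\gamma_1A_2}\,\middle|\,{1,\,1-\Delta_2,\,1-E_1\atop \Delta_1,\,E_2}\right);$$ all Mellin–Barnes integrals involved converge absolutely, with the same value along every line $\mathcal L$ as above. -/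

import Mathlib

open MeasureTheory ProbabilityTheory

noncomputable section

/-- The density of the squared Fisher-Snedecor distribution with mean parameter `g`,
fading parameter `m` and shadowing parameter `ms`; it is supported on `(0, ∞)`. -/
def fisherPDF (g m ms : ℝ) (x : ℝ) : ℝ :=
  if 0 < x then
    m ^ m * (ms - 1) ^ ms * g ^ ms * x ^ (m - 1) /
      (ProbabilityTheory.beta m ms * (m * x + (ms - 1) * g) ^ (m + ms))
  else 0

/-- The squared Fisher-Snedecor law on the real line. -/
def fisherMeasure (g m ms : ℝ) : Measure ℝ :=
  volume.withDensity (fun x => ENNReal.ofReal (fisherPDF g m ms x))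

/-- The integrand of the Mellin-Barnes integral of Meijer's `G^{m,n}_{p,q}(x | a ; b)`:
`∏_{j ≤ m} Γ(b_j - s) ∏_{k ≤ n} Γ(1 - a_k + s) /
  (∏_{j > m} Γ(1 - b_j + s) ∏_{k > n} Γ(a_k - s)) * x ^ s`.
(At a pole of `Γ` Mathlib has `Γ = 0`, hence `Γ⁻¹ = 0`, the correct value of `1 / Γ`.) -/
def meijerIntegrand (m n p q : ℕ) (a : Fin p → ℂ) (b : Fin q → ℂ) (x s : ℂ) : ℂ :=
  (∏ j : Fin q,
      if (j : ℕ) < m then Complex.Gamma (b j - s) else (Complex.Gamma (1 - b j + s))⁻¹) *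
    (∏ k : Fin p,
      if (k : ℕ) < n then Complex.Gamma (1 - a k + s) else (Complex.Gamma (a k - s))⁻¹) *
    x ^ s

/-- The upward vertical line `Re s = c` separates the poles `b_j + ν` of `Γ(b_j - s)`, `j ≤ m`,
which lie on its right, from the poles `a_k - 1 - ν` of `Γ(1 - a_k + s)`, `k ≤ n`, which lie on
its left (`ν = 0, 1, 2, …`). -/
def IsSeparatingLine (m n p q : ℕ) (a : Fin p → ℂ) (b : Fin q → ℂ) (c : ℝ) : Prop :=
  (∀ j : Fin q, (j : ℕ) < m → c < (b j).re) ∧ (∀ k : Fin p, (k : ℕ) < n → (a k).re - 1 < c)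

/-- Meijer's `G^{m,n}_{p,q}(x | a ; b)` exists as a Mellin-Barnes integral and has the value `w`:
there is a separating vertical line, and along every such line the integral
`(1 / (2 π i)) ∫ … ds`, with `s = c + i t` and `ds = i dt`, converges absolutely to `w`. -/
def HasMeijerG (m n p q : ℕ) (a : Fin p → ℂ) (b : Fin q → ℂ) (x w : ℂ) : Prop :=
  (∃ c : ℝ, IsSeparatingLine m n p q a b c) ∧
    ∀ c : ℝ, IsSeparatingLine m n p q a b c →
      Integrable (fun t : ℝ => meijerIntegrand m n p q a b x (c + t * Complex.I)) ∧
      (1 / (2 * Real.pi * Complex.I)) *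
        ∫ t : ℝ, meijerIntegrand m n p q a b x (c + t * Complex.I) * Complex.I = w

/-- The Mellin-Barnes integral of Meijer's `G^{m,n}_{p,q}(x | a ; b)` converges. -/
def MeijerGConverges (m n p q : ℕ) (a : Fin p → ℂ) (b : Fin q → ℂ) (x : ℂ) : Prop :=
  ∃ w : ℂ, HasMeijerG m n p q a b x w

open Classical in
/-- Meijer's `G`-function `G^{m,n}_{p,q}(x | a ; b)`, and `0` if its Mellin-Barnes integral along
separating vertical lines does not converge. -/
def meijerG (m n p q : ℕ) (a : Fin p → ℂ) (b : Fin q → ℂ) (x : ℂ) : ℂ :=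
  if h : MeijerGConverges m n p q a b x then h.choose else 0

/-- The value is determined by the defining property, so the choice in `meijerG` is harmless. -/
theorem HasMeijerG.meijerG_eq {m n p q : ℕ} {a : Fin p → ℂ} {b : Fin q → ℂ} {x w : ℂ}
    (h : HasMeijerG m n p q a b x w) : meijerG m n p q a b x = w := by
  have hc : MeijerGConverges m n p q a b x := ⟨w, h⟩
  obtain ⟨c, hcs⟩ := h.1
  unfold meijerG
  rw [dif_pos hc, ← (hc.choose_spec.2 c hcs).2, (h.2 c hcs).2]

/-- The ratio `Z` of the product of the `X₁ i` to the product of the `X₂ j`. -/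
def ratioOfProducts {Ω : Type*} {L₁ L₂ : ℕ} (X₁ : Fin L₁ → Ω → ℝ) (X₂ : Fin L₂ → Ω → ℝ)
    (ω : Ω) : ℝ :=
  (∏ i, X₁ i ω) / ∏ j, X₂ j ω

/-- `A = ∏ m_ℓ / (m_{s,ℓ} - 1)`. -/
def coeffA {L : ℕ} (m ms : Fin L → ℝ) : ℝ := ∏ i, m i / (ms i - 1)

/-- `B = ∏ Γ(m_ℓ) Γ(m_{s,ℓ})`. -/
def coeffB {L : ℕ} (m ms : Fin L → ℝ) : ℝ := ∏ i, Real.Gamma (m i) * Real.Gamma (ms i)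

/-- The list `Δ` (or `E`) of real parameters, as complex numbers. -/
def params {L : ℕ} (u : Fin L → ℝ) : Fin L → ℂ := fun i => (u i : ℂ)

/-- The list `1 - Δ` (or `1 - E`) of real parameters, as complex numbers. -/
def oneSubParams {L : ℕ} (u : Fin L → ℝ) : Fin L → ℂ := fun i => 1 - (u i : ℂ)

end

/-! Everything is read off from the complex moments E[Z^s], that is, from Mellin transforms. A
positive law is written as k(x) dx/x, so that products of independent variables become
multiplicative convolutions and its moments become the Mellin transform of k. Up to scale, a
Fisher–Snedecor kernel is x^a (x+l)^(-(a+b)). Its moments are l^s Γ(a+s)Γ(b-s)/(Γ(a)Γ(b)) on -a < Re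
s < b, and inversion of the variable exchanges the two Gamma factors. By independence E[Z^s] is
therefore x₀^s times a product of Gamma pairs, divided by B₁B₂ (`exists_hasGammaMoments`).

Mellin inversion turns this into the Mellin–Barnes integral of the density. For the formula to hold
at every z > 0, k must be continuous; this follows by convolving one bounded continuous kernel with
the law of the remaining factors (`exists_hasLaw_prod_haarDensity`). Absolute convergence needs no
Stirling asymptotics: Γ(s+1) = sΓ(s) gives each Gamma factor decay 1/|s|, so one pair is integrable,
and the other pairs are bounded.

The distribution function and the moment generating function are integrals of φ against k(z) dz/z.
Parseval (`integral_haarDensity_eq_mellin`) inserts the Mellin transform of φ under the contour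
integral. The indicator of (0,z] contributes -1/s = Γ(-s)/Γ(1-s) and the condition Re s < 0; the
exponential contributes one more Gamma factor. These are the extra parameters of the two
G-functions. -/

/-! ### Mellin transform of the exponential with complex rate -/

theorem Complex.norm_Gamma_le_Gamma_re {s : ℂ} (hs : 0 < s.re) :
    ‖Complex.Gamma s‖ ≤ Real.Gamma s.re := by
  rw [Complex.Gamma_eq_integral hs, Real.Gamma_eq_integral hs, Complex.GammaIntegral]
  refine (norm_integral_le_integral_norm _).trans_eq ?_
  refine setIntegral_congr_fun measurableSet_Ioi fun x hx => ?_
  simp only [Set.mem_Ioi] at hx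
  simp [Complex.norm_cpow_eq_rpow_re_of_pos hx, Complex.norm_exp]

theorem Complex.continuousAt_Gamma_of_re_pos {s : ℂ} (hs : 0 < s.re) :
    ContinuousAt Complex.Gamma s := by
  refine Complex.continuousAt_Gamma s fun n h => ?_
  rw [h] at hs
  simp at hs
  linarith [n.cast_nonneg (α := ℝ)]

/-- The modulus of the integrand `t ^ (a - 1) * exp (-(r * t))`. -/
theorem norm_cpow_mul_exp_neg {a r : ℂ} {t : ℝ} (ht : 0 < t) :
    ‖(t : ℂ) ^ (a - 1) * Complex.exp (-(r * t))‖ = t ^ (a.re - 1) * Real.exp (-(r.re * t)) := by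
  rw [norm_mul, Complex.norm_cpow_eq_rpow_re_of_pos ht, Complex.norm_exp]
  simp

theorem integrableOn_rpow_mul_exp_neg_mul {a r : ℝ} (ha : 0 < a) (hr : 0 < r) :
    IntegrableOn (fun t : ℝ => t ^ (a - 1) * Real.exp (-(r * t))) (Set.Ioi 0) := by
  have := integrableOn_rpow_mul_exp_neg_mul_rpow (p := 1) (s := a - 1) (b := r) (by linarith)
    one_pos hr
  simpa using this

theorem continuousOn_cpow_Ioi (a : ℂ) :
    ContinuousOn (fun t : ℝ => (t : ℂ) ^ a) (Set.Ioi 0) := fun _ ht =>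
  ((Complex.continuousAt_ofReal_cpow_const _ _ (Or.inr (ne_of_gt ht)))).continuousWithinAt

theorem mellinConvergent_exp_neg_mul {a r : ℂ} (ha : 0 < a.re) (hr : 0 < r.re) :
    MellinConvergent (fun t : ℝ => Complex.exp (-(r * t))) a := by
  refine (integrableOn_rpow_mul_exp_neg_mul ha hr).mono' ?_ ?_
  · refine ContinuousOn.aestronglyMeasurable ?_ measurableSet_Ioi
    exact (continuousOn_cpow_Ioi _).mul (by fun_prop)
  · refine (ae_restrict_iff' measurableSet_Ioi).2 (.of_forall fun t ht => ?_)
    simpa only [smul_eq_mul] using (norm_cpow_mul_exp_neg ht).le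

/-- Holomorphy in the rate lets the formula known for real rates be continued to the half-plane.
Near r, the differentiated integrand is dominated on Re w > Re r / 2. -/
theorem differentiableOn_mellin_exp_neg_mul {a : ℂ} (ha : 0 < a.re) :
    DifferentiableOn ℂ (fun r : ℂ => mellin (fun t : ℝ => Complex.exp (-(r * t))) a)
      {r | 0 < r.re} := by
  intro r hr
  simp only [Set.mem_ofPred_eq] at hr
  refine DifferentiableAt.differentiableWithinAt ?_
  have hs : {w : ℂ | r.re / 2 < w.re} ∈ nhds r :=
    (isOpen_lt continuous_const Complex.continuous_re).mem_nhds (by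
      simp only [Set.mem_ofPred_eq]; linarith)
  have hmeas : ∀ w b : ℂ, AEStronglyMeasurable
      (fun t : ℝ => (t : ℂ) ^ (b - 1) * Complex.exp (-(w * t)))
      (volume.restrict (Set.Ioi 0)) := fun w b =>
    ContinuousOn.aestronglyMeasurable ((continuousOn_cpow_Ioi _).mul (by fun_prop))
      measurableSet_Ioi
  have key := hasDerivAt_integral_of_dominated_loc_of_deriv_le
    (μ := volume.restrict (Set.Ioi (0 : ℝ)))
    (F := fun (w : ℂ) (t : ℝ) => (t : ℂ) ^ (a - 1) • Complex.exp (-(w * t)))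
    (F' := fun (w : ℂ) (t : ℝ) => -((t : ℂ) ^ ((a + 1) - 1) * Complex.exp (-(w * t))))
    (bound := fun t => t ^ ((a.re + 1) - 1) * Real.exp (-(r.re / 2 * t)))
    (x₀ := r) hs (.of_forall fun w => by simpa using hmeas w a)
    (mellinConvergent_exp_neg_mul ha hr) (hmeas r (a + 1)).neg ?_
    (integrableOn_rpow_mul_exp_neg_mul (by linarith) (by linarith)) ?_
  · exact key.2.differentiableAt
  · refine (ae_restrict_iff' measurableSet_Ioi).2 (.of_forall fun t ht w hw => ?_)
    simp only [Set.mem_Ioi, Set.mem_ofPred_eq] at ht hw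
    rw [norm_neg, norm_cpow_mul_exp_neg ht]
    simp only [Complex.add_re, Complex.one_re]
    gcongr
  · refine (ae_restrict_iff' measurableSet_Ioi).2 (.of_forall fun t ht w _ => ?_)
    simp only [Set.mem_Ioi] at ht
    have h1 : HasDerivAt (fun w : ℂ => Complex.exp (-(w * t)))
        (Complex.exp (-(w * t)) * (-(1 * (t : ℂ)))) w :=
      (((hasDerivAt_id w).mul_const (t : ℂ)).neg).cexp
    have h2 := h1.const_mul ((t : ℂ) ^ (a - 1))
    simp only [smul_eq_mul]
    refine h2.congr_deriv ?_
    rw [show a + 1 - 1 = (a - 1) + 1 by ring,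
      Complex.cpow_add _ _ (Complex.ofReal_ne_zero.2 ht.ne'), Complex.cpow_one]
    ring

/-- The Mellin transform of `t ↦ exp (-r t)` for a complex `r` of positive real part. -/
theorem mellin_exp_neg_mul {a r : ℂ} (ha : 0 < a.re) (hr : 0 < r.re) :
    mellin (fun t : ℝ => Complex.exp (-(r * t))) a = (1 / r) ^ a * Complex.Gamma a := by
  have hopen : IsOpen {r : ℂ | 0 < r.re} := isOpen_lt continuous_const Complex.continuous_re
  have hconn : IsPreconnected {r : ℂ | 0 < r.re} :=
    (convex_halfSpace_re_gt 0).isPreconnected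
  have hg : DifferentiableOn ℂ (fun r : ℂ => (1 / r) ^ a * Complex.Gamma a) {r | 0 < r.re} := by
    intro w hw
    simp only [Set.mem_ofPred_eq] at hw
    have hw0 : w ≠ 0 := by rintro rfl; simp at hw
    refine DifferentiableAt.differentiableWithinAt ?_
    refine DifferentiableAt.mul_const ?_ _
    refine DifferentiableAt.cpow_const ?_ ?_
    · exact (differentiableAt_const _).div differentiableAt_id hw0
    · refine Or.inl ?_
      rw [one_div, Complex.inv_re]
      exact div_pos hw (Complex.normSq_pos.2 hw0)
  refine AnalyticOnNhd.eqOn_of_preconnected_of_frequently_eq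
    ((differentiableOn_mellin_exp_neg_mul ha).analyticOnNhd hopen)
    (hg.analyticOnNhd hopen) hconn (z₀ := 1) (by simp) ?_ hr
  -- Identity theorem: the real rates 1 + 1/(n+1) accumulate at 1 without reaching it, and there the
  -- real-rate formula applies.
  have hseq : Filter.Tendsto (fun n : ℕ => (((1 + 1 / ((n : ℝ) + 1) : ℝ)) : ℂ)) Filter.atTop
      (nhdsWithin 1 {1}ᶜ) := by
    refine tendsto_nhdsWithin_iff.2 ⟨?_, .of_forall fun n => ?_⟩
    · have h : Filter.Tendsto (fun n : ℕ => (1 + 1 / ((n : ℝ) + 1) : ℝ)) Filter.atTop (nhds 1) := by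
        simpa using tendsto_one_div_add_atTop_nhds_zero_nat.const_add (1 : ℝ)
      have h2 := (Complex.continuous_ofReal.tendsto (1 : ℝ)).comp h
      rw [Complex.ofReal_one] at h2
      exact h2
    · have : (0 : ℝ) < 1 / ((n : ℝ) + 1) := by positivity
      intro h
      have h' := congrArg Complex.re h
      simp only [Complex.ofReal_re, Complex.one_re] at h'
      linarith
  refine hseq.frequently (Filter.Eventually.frequently (.of_forall fun n => ?_))
  have hpos : (0 : ℝ) < 1 + 1 / ((n : ℝ) + 1) := by positivity
  simpa [mellin] using Complex.integral_cpow_mul_exp_neg_mul_Ioi ha hpos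

/-! ### Decay of Gamma products along vertical lines -/

/-- One use of Γ(s+1) = sΓ(s) gains a factor 1/|s|; two such factors already give an integrable
bound. -/
theorem Complex.norm_Gamma_le_div_norm {s : ℂ} (hs : 0 < s.re) :
    ‖Complex.Gamma s‖ ≤ Real.Gamma (s.re + 1) / ‖s‖ := by
  have h0 : s ≠ 0 := by rintro rfl; simp at hs
  rw [le_div_iff₀ (norm_pos_iff.2 h0), mul_comm, ← norm_mul, ← Complex.Gamma_add_one s h0]
  simpa using Complex.norm_Gamma_le_Gamma_re (s := s + 1) (by simp; linarith)

/-- Products of two Gamma functions are integrable along vertical lines. -/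
theorem integrable_Gamma_add_mul_Gamma_sub {a b c : ℝ} (ha : 0 < a + c) (hb : 0 < b - c) :
    Integrable fun t : ℝ => Complex.Gamma (a + (c + t * Complex.I)) *
      Complex.Gamma (b - (c + t * Complex.I)) := by
  have hre1 : ∀ t : ℝ, ((a : ℂ) + (c + t * Complex.I)).re = a + c := by intro t; simp
  have hre2 : ∀ t : ℝ, ((b : ℂ) - (c + t * Complex.I)).re = b - c := by intro t; simp
  have him1 : ∀ t : ℝ, ((a : ℂ) + (c + t * Complex.I)).im = t := by intro t; simp
  have him2 : ∀ t : ℝ, ((b : ℂ) - (c + t * Complex.I)).im = -t := by intro t; simp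
  have hcont : Continuous fun t : ℝ => Complex.Gamma (a + (c + t * Complex.I)) *
      Complex.Gamma (b - (c + t * Complex.I)) := by
    refine continuous_iff_continuousAt.2 fun t => ContinuousAt.mul ?_ ?_
    · exact ContinuousAt.comp (f := fun t : ℝ => (a : ℂ) + (c + t * Complex.I))
        (Complex.continuousAt_Gamma_of_re_pos (by rwa [hre1])) (by fun_prop)
    · exact ContinuousAt.comp (f := fun t : ℝ => (b : ℂ) - (c + t * Complex.I))
        (Complex.continuousAt_Gamma_of_re_pos (by rwa [hre2])) (by fun_prop)
  -- With d ≤ 1 and d ≤ Re w, |w|² ≥ d² + (Im w)² ≥ d²(1 + (Im w)²), uniformly for both arguments.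
  set d := min 1 (min (a + c) (b - c)) with hd
  have hd0 : 0 < d := by simp [hd, ha, hb]
  have hd1 : d ≤ 1 := min_le_left _ _
  have hlow : ∀ (w : ℂ), d ≤ w.re → d ^ 2 * (1 + w.im ^ 2) ≤ ‖w‖ ^ 2 := by
    intro w hw
    rw [← Complex.normSq_eq_norm_sq, Complex.normSq_apply]
    nlinarith [sq_nonneg w.im, mul_nonneg (sub_nonneg.2 hd1) (sq_nonneg w.im),
      mul_nonneg hd0.le (mul_nonneg (sub_nonneg.2 hd1) (sq_nonneg w.im))]
  have hC : 0 < Real.Gamma (a + c + 1) * Real.Gamma (b - c + 1) :=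
    mul_pos (Real.Gamma_pos_of_pos (by linarith)) (Real.Gamma_pos_of_pos (by linarith))
  refine (integrable_inv_one_add_sq.const_mul
    (Real.Gamma (a + c + 1) * Real.Gamma (b - c + 1) / d ^ 2)).mono'
    hcont.aestronglyMeasurable (.of_forall fun t => ?_)
  set u := (a : ℂ) + (c + t * Complex.I)
  set v := (b : ℂ) - (c + t * Complex.I)
  have hu := Complex.norm_Gamma_le_div_norm (s := u) (by rwa [hre1])
  have hv := Complex.norm_Gamma_le_div_norm (s := v) (by rwa [hre2])
  have hlu := hlow u (by rw [hre1]; exact (min_le_right _ _).trans (min_le_left _ _))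
  have hlv := hlow v (by rw [hre2]; exact (min_le_right _ _).trans (min_le_right _ _))
  rw [hre1] at hu
  rw [hre2] at hv
  rw [him1] at hlu
  rw [him2, neg_sq] at hlv
  have hu0 : 0 < ‖u‖ := norm_pos_iff.2 fun h => by
    have := hre1 t; rw [show (a : ℂ) + (c + t * Complex.I) = u from rfl, h] at this
    simp at this; linarith
  have hv0 : 0 < ‖v‖ := norm_pos_iff.2 fun h => by
    have := hre2 t; rw [show (b : ℂ) - (c + t * Complex.I) = v from rfl, h] at this
    simp at this; linarith
  have hle : d ^ 2 * (1 + t ^ 2) ≤ ‖u‖ * ‖v‖ := by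
    refine (pow_le_pow_iff_left₀ (by positivity) (by positivity) two_ne_zero).1 ?_
    rw [mul_pow ‖u‖, sq (d ^ 2 * (1 + t ^ 2))]
    exact mul_le_mul hlu hlv (by positivity) (by positivity)
  rw [norm_mul]
  calc _ ≤ Real.Gamma (a + c + 1) / ‖u‖ * (Real.Gamma (b - c + 1) / ‖v‖) :=
        mul_le_mul hu hv (norm_nonneg _) ((norm_nonneg _).trans hu)
    _ = Real.Gamma (a + c + 1) * Real.Gamma (b - c + 1) / (‖u‖ * ‖v‖) := by
        rw [div_mul_div_comm]
    _ ≤ Real.Gamma (a + c + 1) * Real.Gamma (b - c + 1) / (d ^ 2 * (1 + t ^ 2)) := by gcongr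
    _ = _ := by rw [← div_div, div_eq_mul_inv _ (1 + t ^ 2)]

/-! ### Mellin transform of a shifted power -/

theorem integral_rpow_mul_exp_neg_mul_eq {a r : ℝ} (ha : 0 < a) (hr : 0 < r) :
    ∫ t in Set.Ioi (0 : ℝ), t ^ (a - 1) * Real.exp (-(r * t)) = r ^ (-a) * Real.Gamma a := by
  rw [Real.integral_rpow_mul_exp_neg_mul_Ioi ha hr, one_div, Real.inv_rpow hr.le,
    Real.rpow_neg hr.le]

/-- The Mellin transform of `x ↦ (x + l) ^ (-p)`. -/
theorem hasMellin_add_rpow_neg {l p : ℝ} (hl : 0 < l) {u : ℂ} (hu : 0 < u.re) (hup : u.re < p) :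
    HasMellin (fun x : ℝ => (((x + l) ^ (-p) : ℝ) : ℂ)) u
      ((l : ℂ) ^ (u - p) * (Complex.Gamma u * Complex.Gamma (p - u)) / Real.Gamma p) := by
  have hp : 0 < p := hu.trans hup
  have hG : Real.Gamma p ≠ 0 := (Real.Gamma_pos_of_pos hp).ne'
  set μ := (volume : Measure ℝ).restrict (Set.Ioi 0) with hμ
  -- Γ(p)(x+l)^(-p) is the integral of t^(p-1) e^(-(x+l)t). After Fubini the x-integral gives Γ(u)
  -- t^(-u), and the t-integral then gives Γ(p-u) l^(u-p).
  set F : ℝ → ℝ → ℂ := fun x t => ((x : ℂ) ^ (u - 1) * Complex.exp (-((t : ℂ) * x))) *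
    ((t : ℂ) ^ ((p : ℂ) - 1) * Complex.exp (-((l : ℂ) * t))) with hF
  have hmeas : AEStronglyMeasurable (Function.uncurry F) (μ.prod μ) := by
    have hc : Measurable fun x : ℝ => (x : ℂ) := Complex.measurable_ofReal
    refine Measurable.aestronglyMeasurable ?_
    simp only [hF, Function.uncurry_def]
    fun_prop
  have hae : ∀ {q : ℝ → Prop}, (∀ x, 0 < x → q x) → ∀ᵐ x ∂μ, q x := fun {q} h =>
    (ae_restrict_iff' measurableSet_Ioi).2 (.of_forall h)
  have hnorm : ∀ x t : ℝ, 0 < x → 0 < t → ‖F x t‖ =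
      (x ^ (u.re - 1) * Real.exp (-(t * x))) * (t ^ (p - 1) * Real.exp (-(l * t))) := by
    intro x t hx ht
    simp only [hF]
    rw [norm_mul, norm_cpow_mul_exp_neg hx, norm_cpow_mul_exp_neg ht]
    simp
  have hint : Integrable (Function.uncurry F) (μ.prod μ) := by
    refine (integrable_prod_iff' hmeas).2 ⟨hae fun t ht => ?_, ?_⟩
    · exact Integrable.mul_const (f := fun x : ℝ => (x : ℂ) ^ (u - 1) * Complex.exp (-((t : ℂ) * x)))
        (mellinConvergent_exp_neg_mul hu (r := t) (by simpa using ht))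
        ((t : ℂ) ^ ((p : ℂ) - 1) * Complex.exp (-((l : ℂ) * t)))
    · refine Integrable.congr (f := fun t : ℝ => Real.Gamma u.re *
        (t ^ ((p - u.re) - 1) * Real.exp (-(l * t)))) ?_ (hae fun t ht => ?_)
      · exact (integrableOn_rpow_mul_exp_neg_mul (by linarith) hl).const_mul _
      · simp only [Function.uncurry_apply_pair]
        rw [integral_congr_ae (hae fun x hx => hnorm x t hx ht), integral_mul_const,
          integral_rpow_mul_exp_neg_mul_eq hu ht, show p - u.re - 1 = -u.re + (p - 1) by ring,
          Real.rpow_add ht]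
        ring
  have hin : ∀ x : ℝ, 0 < x → ∫ t, F x t ∂μ =
      (x : ℂ) ^ (u - 1) * ((((x + l) ^ (-p) : ℝ) : ℂ) * Real.Gamma p) := by
    intro x hx
    have h1 : ∀ t : ℝ, F x t = (x : ℂ) ^ (u - 1) *
        ((t : ℂ) ^ ((p : ℂ) - 1) * Complex.exp (-(((x + l : ℝ) : ℂ) * t))) := by
      intro t
      simp only [hF]
      rw [show -(((x + l : ℝ) : ℂ) * t) = -((t : ℂ) * x) + -((l : ℂ) * t) by push_cast; ring,
        Complex.exp_add]
      ring
    have hxl : 0 < x + l := by linarith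
    simp only [h1]
    rw [integral_const_mul, Complex.integral_cpow_mul_exp_neg_mul_Ioi (by simpa using hp) hxl,
      Complex.Gamma_ofReal, Complex.ofReal_cpow hxl.le, one_div, Complex.ofReal_neg,
      Complex.cpow_neg, Complex.inv_cpow]
    rw [Complex.arg_ofReal_of_nonneg hxl.le]
    exact Real.pi_pos.ne
  have hGc : (Real.Gamma p : ℂ) ≠ 0 := Complex.ofReal_ne_zero.2 hG
  have hconv : ∀ᵐ x ∂μ, (∫ t, F x t ∂μ) * (Real.Gamma p : ℂ)⁻¹ =
      (x : ℂ) ^ (u - 1) • (((x + l) ^ (-p) : ℝ) : ℂ) := hae fun x hx => by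
    rw [hin x hx, smul_eq_mul, ← mul_assoc, mul_assoc _ _ (_ : ℂ)⁻¹, mul_inv_cancel₀ hGc, mul_one]
  refine ⟨(hint.integral_prod_left.mul_const _).congr hconv, ?_⟩
  rw [mellin, ← integral_congr_ae hconv, integral_mul_const, integral_integral_swap hint]
  have hout : ∀ t : ℝ, 0 < t → ∫ x, F x t ∂μ =
      Complex.Gamma u * ((t : ℂ) ^ (((p : ℂ) - u) - 1) * Complex.exp (-((l : ℂ) * t))) := by
    intro t ht
    simp only [hF]
    rw [integral_mul_const, Complex.integral_cpow_mul_exp_neg_mul_Ioi hu ht,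
      show (p : ℂ) - u - 1 = -u + (p - 1) by ring,
      Complex.cpow_add _ _ (Complex.ofReal_ne_zero.2 ht.ne'), one_div, Complex.cpow_neg,
      Complex.inv_cpow]
    · ring
    · rw [Complex.arg_ofReal_of_nonneg ht.le]
      exact Real.pi_pos.ne
  rw [integral_congr_ae (hae hout), integral_const_mul,
    Complex.integral_cpow_mul_exp_neg_mul_Ioi (by simpa using hup) hl, one_div,
    show u - (p : ℂ) = -(p - u) by ring, Complex.cpow_neg, Complex.inv_cpow]
  · ring
  · rw [Complex.arg_ofReal_of_nonneg hl.le]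
    exact Real.pi_pos.ne

/-! ### Laws with a density relative to dx/x -/

/-- The measure on `(0, ∞)` with density `k x / x`, that is, with density `k` with respect to the
multiplicative Haar measure. -/
noncomputable def haarDensity (k : ℝ → ℝ) : Measure ℝ :=
  (volume.restrict (Set.Ioi 0)).withDensity fun x => ENNReal.ofReal (k x / x)

theorem ae_pos_haarDensity (k : ℝ → ℝ) : ∀ᵐ x ∂haarDensity k, 0 < x :=
  (withDensity_absolutelyContinuous _ _).ae_le (ae_restrict_mem measurableSet_Ioi)

theorem haarDensity_apply (k : ℝ → ℝ) {A : Set ℝ} (hA : MeasurableSet A) :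
    haarDensity k A = ∫⁻ x in Set.Ioi 0, A.indicator (fun x => ENNReal.ofReal (k x / x)) x := by
  rw [haarDensity, withDensity_apply _ hA, lintegral_indicator hA]

theorem integrable_haarDensity_iff {k : ℝ → ℝ} (hk : Measurable k) (hk0 : ∀ x, 0 < x → 0 ≤ k x)
    (f : ℝ → ℂ) :
    Integrable f (haarDensity k) ↔
      IntegrableOn (fun x : ℝ => (x : ℂ)⁻¹ * (k x * f x)) (Set.Ioi 0) := by
  rw [haarDensity, integrable_withDensity_iff_integrable_smul' (by fun_prop)
    (.of_forall fun x => ENNReal.ofReal_lt_top)]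
  refine integrable_congr ((ae_restrict_iff' measurableSet_Ioi).2 (.of_forall fun x hx => ?_))
  simp only [Set.mem_Ioi] at hx
  beta_reduce
  rw [ENNReal.toReal_ofReal (div_nonneg (hk0 x hx) hx.le), Complex.real_smul, Complex.ofReal_div]
  ring

theorem integral_haarDensity {k : ℝ → ℝ} (hk : Measurable k) (hk0 : ∀ x, 0 < x → 0 ≤ k x)
    (f : ℝ → ℂ) :
    ∫ x, f x ∂haarDensity k = ∫ x in Set.Ioi (0 : ℝ), (x : ℂ)⁻¹ * (k x * f x) := by
  rw [haarDensity, integral_withDensity_eq_integral_toReal_smul (by fun_prop)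
    (.of_forall fun x => ENNReal.ofReal_lt_top)]
  refine setIntegral_congr_fun measurableSet_Ioi fun x hx => ?_
  simp only [Set.mem_Ioi] at hx
  rw [ENNReal.toReal_ofReal (div_nonneg (hk0 x hx) hx.le), Complex.real_smul, Complex.ofReal_div]
  ring

/-! ### The Fisher–Snedecor kernel and its moments -/

/-- The density of the squared Fisher-Snedecor law with respect to the multiplicative Haar
measure. -/
noncomputable def fisherKernel (l a b : ℝ) (x : ℝ) : ℝ :=
  if 0 < x then l ^ b * Real.Gamma (a + b) / (Real.Gamma a * Real.Gamma b) *
    (x ^ a * (x + l) ^ (-(a + b))) else 0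

theorem measurable_fisherKernel (l a b : ℝ) : Measurable (fisherKernel l a b) := by
  unfold fisherKernel
  refine Measurable.ite measurableSet_Ioi ?_ measurable_const
  fun_prop

theorem fisherKernel_nonneg {l a b : ℝ} (hl : 0 < l) (ha : 0 < a) (hb : 0 < b) (x : ℝ) :
    0 ≤ fisherKernel l a b x := by
  unfold fisherKernel
  split_ifs with hx
  · have := Real.Gamma_pos_of_pos ha
    have := Real.Gamma_pos_of_pos hb
    have := Real.Gamma_pos_of_pos (add_pos ha hb)
    positivity
  · rfl

theorem continuousOn_fisherKernel {l a b : ℝ} (hl : 0 < l) :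
    ContinuousOn (fisherKernel l a b) (Set.Ioi 0) := by
  refine ContinuousOn.congr (f := fun x => l ^ b * Real.Gamma (a + b) /
    (Real.Gamma a * Real.Gamma b) * (x ^ a * (x + l) ^ (-(a + b)))) ?_ fun x hx => if_pos hx
  refine continuousOn_const.mul (ContinuousOn.mul ?_ ?_)
  · exact continuousOn_id.rpow_const fun x hx => Or.inl (ne_of_gt hx)
  · refine ContinuousOn.rpow_const (by fun_prop) fun x hx => Or.inl ?_
    simp only [Set.mem_Ioi] at hx
    linarith

/-- Both x and l are at most x + l, so x^a l^b ≤ (x+l)^(a+b). The bound serves as the constant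
dominating function in convolutions. -/
theorem fisherKernel_le {l a b : ℝ} (hl : 0 < l) (ha : 0 < a) (hb : 0 < b) (x : ℝ) :
    fisherKernel l a b x ≤ Real.Gamma (a + b) / (Real.Gamma a * Real.Gamma b) := by
  have h1 := Real.Gamma_pos_of_pos ha
  have h2 := Real.Gamma_pos_of_pos hb
  have h3 := Real.Gamma_pos_of_pos (add_pos ha hb)
  unfold fisherKernel
  split_ifs with hx
  · have hxl : 0 < x + l := by linarith
    have e1 : x ^ a ≤ (x + l) ^ a := Real.rpow_le_rpow hx.le (by linarith) ha.le
    have e2 : l ^ b ≤ (x + l) ^ b := Real.rpow_le_rpow hl.le (by linarith) hb.le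
    have e3 : l ^ b * (x ^ a * (x + l) ^ (-(a + b))) ≤ 1 := by
      rw [Real.rpow_neg hxl.le, ← mul_assoc, ← div_eq_mul_inv, div_le_one (by positivity),
        Real.rpow_add hxl, mul_comm]
      gcongr
    calc _ = Real.Gamma (a + b) / (Real.Gamma a * Real.Gamma b) *
          (l ^ b * (x ^ a * (x + l) ^ (-(a + b)))) := by ring
      _ ≤ Real.Gamma (a + b) / (Real.Gamma a * Real.Gamma b) * 1 := by gcongr
      _ = _ := mul_one _
  · positivity

/-- Factoring m out of mx + (ms-1)g leaves the single scale l = (ms-1)g/m. -/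
theorem fisherMeasure_eq_haarDensity {g m ms : ℝ} (hg : 0 < g) (hm : 0 < m) (hms : 1 < ms) :
    fisherMeasure g m ms = haarDensity (fisherKernel ((ms - 1) * g / m) m ms) := by
  rw [fisherMeasure, haarDensity, ← withDensity_indicator measurableSet_Ioi]
  congr 1
  ext1 x
  by_cases hx : 0 < x
  · rw [Set.indicator_of_mem (by exact hx), fisherPDF, fisherKernel, if_pos hx, if_pos hx]
    congr 1
    have h0 : 0 < ms - 1 := by linarith
    have h1 : m * x + (ms - 1) * g = m * (x + (ms - 1) * g / m) := by field_simp
    have h2 : 0 < x + (ms - 1) * g / m := by positivity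
    rw [h1, Real.mul_rpow hm.le h2.le, beta, Real.rpow_neg h2.le, Real.rpow_add hm,
      Real.div_rpow (by positivity) hm.le, Real.mul_rpow h0.le hg.le, Real.rpow_sub hx,
      Real.rpow_one]
    have e1 := Real.Gamma_pos_of_pos hm
    have e2 := Real.Gamma_pos_of_pos (show 0 < ms by linarith)
    have e3 := Real.Gamma_pos_of_pos (show 0 < m + ms by linarith)
    have e4 := Real.rpow_pos_of_pos hm m
    have e5 := Real.rpow_pos_of_pos hm ms
    have e6 := Real.rpow_pos_of_pos h2 (m + ms)
    field_simp
  · rw [Set.indicator_of_notMem (by exact hx), fisherPDF, if_neg hx, ENNReal.ofReal_zero]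

/-- Complex moments of the law with kernel `fisherKernel`. -/
theorem integral_cpow_haarDensity_fisherKernel {l a b : ℝ} (hl : 0 < l) (ha : 0 < a) (hb : 0 < b)
    {s : ℂ} (hs1 : -a < s.re) (hs2 : s.re < b) :
    Integrable (fun x : ℝ => (x : ℂ) ^ s) (haarDensity (fisherKernel l a b)) ∧
    ∫ x : ℝ, (x : ℂ) ^ s ∂haarDensity (fisherKernel l a b) =
      (l : ℂ) ^ s * (Complex.Gamma (a + s) * Complex.Gamma (b - s)) /
        (Real.Gamma a * Real.Gamma b : ℝ) := by
  have hM := hasMellin_add_rpow_neg hl (p := a + b) (u := a + s) (by simp; linarith)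
    (by simp; linarith)
  set C : ℝ := l ^ b * Real.Gamma (a + b) / (Real.Gamma a * Real.Gamma b) with hC
  have hEq : Set.EqOn (fun x : ℝ => (C : ℂ) * ((x : ℂ) ^ ((a : ℂ) + s - 1) •
      (((x + l) ^ (-(a + b)) : ℝ) : ℂ)))
      (fun x : ℝ => (x : ℂ)⁻¹ * (fisherKernel l a b x * (x : ℂ) ^ s)) (Set.Ioi 0) := by
    intro x hx
    simp only [Set.mem_Ioi] at hx
    have hx0 : (x : ℂ) ≠ 0 := Complex.ofReal_ne_zero.2 hx.ne'
    simp only [fisherKernel, if_pos hx, ← hC, smul_eq_mul]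
    rw [Complex.cpow_sub _ _ hx0, Complex.cpow_add _ _ hx0, Complex.cpow_one, Complex.ofReal_mul,
      Complex.ofReal_mul, Complex.ofReal_cpow hx.le]
    field_simp
  have hk := measurable_fisherKernel l a b
  have hk0 := fun x (_ : 0 < x) => fisherKernel_nonneg hl ha hb x
  refine ⟨(integrable_haarDensity_iff hk hk0 _).2
    (IntegrableOn.congr_fun (hM.1.const_mul _) hEq measurableSet_Ioi), ?_⟩
  rw [integral_haarDensity hk hk0, ← setIntegral_congr_fun measurableSet_Ioi hEq,
    integral_const_mul]
  have h2 := hM.2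
  rw [mellin] at h2
  rw [h2, hC]
  have hl0 : (l : ℂ) ≠ 0 := Complex.ofReal_ne_zero.2 hl.ne'
  have e1 := Complex.ofReal_ne_zero.2 (Real.Gamma_pos_of_pos ha).ne'
  have e2 := Complex.ofReal_ne_zero.2 (Real.Gamma_pos_of_pos hb).ne'
  have e3 := Complex.ofReal_ne_zero.2 (Real.Gamma_pos_of_pos (add_pos ha hb)).ne'
  have e4 : (l : ℂ) ^ ((a : ℂ) + s - (a + b : ℝ)) = (l : ℂ) ^ s / (l : ℂ) ^ (b : ℂ) := by
    rw [← Complex.cpow_sub _ _ hl0]; congr 1; push_cast; ring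
  have e5 : (l : ℂ) ^ (b : ℂ) ≠ 0 := by simp [Complex.cpow_eq_zero_iff, hl0]
  rw [e4, show ((a + b : ℝ) : ℂ) - (a + s) = b - s by push_cast; ring]
  push_cast [Complex.ofReal_cpow hl.le]
  field_simp

/-! ### Inversion, scaling and multiplicative convolution -/

/-- The condition |g'| = g/x says that g preserves dx/x, so the change of variables leaves no
Jacobian. -/
theorem map_haarDensity_comp {k g g' : ℝ → ℝ} (hg : Measurable g)
    (hg' : ∀ x, 0 < x → HasDerivAt g (g' x) x) (hinj : Set.InjOn g (Set.Ioi 0))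
    (himg : g '' Set.Ioi 0 = Set.Ioi 0) (habs : ∀ x, 0 < x → |g' x| = g x / x) :
    (haarDensity fun x => k (g x)).map g = haarDensity k := by
  ext A hA
  rw [Measure.map_apply hg hA, haarDensity_apply _ (hg hA), haarDensity_apply _ hA]
  conv_rhs => rw [← himg]
  rw [lintegral_image_eq_lintegral_abs_deriv_mul measurableSet_Ioi
    (fun x hx => (hg' x hx).hasDerivWithinAt) hinj]
  refine setLIntegral_congr_fun measurableSet_Ioi fun x hx => ?_
  simp only [Set.mem_Ioi] at hx
  have hgx : 0 < g x := by
    have : g x ∈ g '' Set.Ioi 0 := ⟨x, hx, rfl⟩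
    rwa [himg] at this
  by_cases hA' : g x ∈ A
  · rw [Set.indicator_of_mem (by exact hA'), Set.indicator_of_mem hA',
      ← ENNReal.ofReal_mul (abs_nonneg _), habs x hx]
    congr 1
    field_simp
  · rw [Set.indicator_of_notMem (by exact hA'), Set.indicator_of_notMem hA', mul_zero]

theorem map_inv_haarDensity (k : ℝ → ℝ) :
    (haarDensity k).map (·⁻¹) = haarDensity fun x => k x⁻¹ := by
  have h := map_haarDensity_comp (k := fun x => k x⁻¹) (g := fun x => x⁻¹)
    (g' := fun x => -(x ^ 2)⁻¹) measurable_inv (fun x hx => hasDerivAt_inv hx.ne')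
    inv_injective.injOn ?_ fun x hx => ?_
  · simpa only [inv_inv] using h
  · ext x
    simp only [Set.mem_image, Set.mem_Ioi]
    exact ⟨fun ⟨y, hy, h⟩ => h ▸ inv_pos.2 hy, fun hx => ⟨x⁻¹, inv_pos.2 hx, inv_inv x⟩⟩
  · rw [abs_neg, abs_of_nonneg (by positivity)]
    field_simp

theorem map_mul_right_haarDensity (k : ℝ → ℝ) {w : ℝ} (hw : 0 < w) :
    (haarDensity k).map (· * w) = haarDensity fun x => k (x / w) := by
  have h := map_haarDensity_comp (k := fun x => k (x / w)) (g := fun x => x * w)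
    (g' := fun _ => w) (measurable_id.mul_const w) (fun x _ => hasDerivAt_mul_const w)
    (mul_left_injective₀ hw.ne').injOn ?_ fun x hx => ?_
  · simpa only [mul_div_cancel_right₀ _ hw.ne'] using h
  · ext x
    simp only [Set.mem_image, Set.mem_Ioi]
    exact ⟨fun ⟨y, hy, h⟩ => h ▸ mul_pos hy hw, fun hx =>
      ⟨x / w, div_pos hx hw, div_mul_cancel₀ x hw.ne'⟩⟩
  · rw [abs_of_pos hw]
    field_simp

/-- Multiplicative convolution of a law with bounded kernel `k` and a law on `(0, ∞)`. -/
theorem mconv_haarDensity {k : ℝ → ℝ} (hk : Measurable k) (hk0 : ∀ x, 0 ≤ k x) {K : ℝ}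
    (hkK : ∀ x, k x ≤ K) [IsFiniteMeasure (haarDensity k)] (ν : Measure ℝ) [IsFiniteMeasure ν]
    (hν : ∀ᵐ w ∂ν, 0 < w) :
    (haarDensity k).mconv ν = haarDensity fun z => ∫ w, k (z / w) ∂ν := by
  ext A hA
  have hmul : Measurable fun p : ℝ × ℝ => p.1 * p.2 := measurable_fst.mul measurable_snd
  rw [Measure.mconv, Measure.map_apply hmul hA, Measure.prod_apply_symm (hmul hA)]
  -- For fixed w > 0 the product is a rescaling, with kernel k(·/w); Tonelli then averages over w.
  have h1 : ∀ᵐ w ∂ν, haarDensity k ((fun x => (x, w)) ⁻¹' ((fun p : ℝ × ℝ => p.1 * p.2) ⁻¹' A)) =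
      ∫⁻ z in Set.Ioi 0, A.indicator (fun z => ENNReal.ofReal (k (z / w) / z)) z := by
    filter_upwards [hν] with w hw
    rw [← haarDensity_apply (fun z => k (z / w)) hA, ← map_mul_right_haarDensity k hw,
      Measure.map_apply (by fun_prop) hA]
    rfl
  rw [lintegral_congr_ae h1, haarDensity_apply _ hA, lintegral_lintegral_swap]
  · refine setLIntegral_congr_fun measurableSet_Ioi fun z hz => ?_
    simp only [Set.mem_Ioi] at hz
    by_cases hzA : z ∈ A
    · simp only [Set.indicator_of_mem hzA]
      rw [← integral_div, ofReal_integral_eq_lintegral_ofReal]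
      · refine Integrable.div_const ?_ _
        refine Integrable.mono' (integrable_const K)
          (hk.comp (measurable_const.div measurable_id)).aestronglyMeasurable
          (.of_forall fun w => ?_)
        rw [Real.norm_of_nonneg (hk0 _)]
        exact hkK _
      · exact .of_forall fun w => div_nonneg (hk0 _) hz.le
    · simp only [Set.indicator_of_notMem hzA, lintegral_zero]
  · refine Measurable.aemeasurable ?_
    have : (Function.uncurry fun (w z : ℝ) =>
        A.indicator (fun z => ENNReal.ofReal (k (z / w) / z)) z) =
        (Prod.snd ⁻¹' A).indicator fun p : ℝ × ℝ => ENNReal.ofReal (k (p.2 / p.1) / p.2) := by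
      ext ⟨w, z⟩
      rfl
    rw [this]
    refine Measurable.indicator ?_ (measurable_snd hA)
    fun_prop

theorem continuousOn_integral_comp_div {k : ℝ → ℝ} (hk : Measurable k) (hk0 : ∀ x, 0 ≤ k x) {K : ℝ}
    (hkK : ∀ x, k x ≤ K) (hkc : ContinuousOn k (Set.Ioi 0)) (ν : Measure ℝ) [IsFiniteMeasure ν]
    (hν : ∀ᵐ w ∂ν, 0 < w) :
    ContinuousOn (fun z => ∫ w, k (z / w) ∂ν) (Set.Ioi 0) := by
  intro z hz
  refine ContinuousAt.continuousWithinAt ?_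
  refine continuousAt_of_dominated (bound := fun _ => K) ?_ ?_ (integrable_const K) ?_
  · exact .of_forall fun z =>
      (hk.comp (measurable_const.div measurable_id)).aestronglyMeasurable
  · exact .of_forall fun z => .of_forall fun w => by
      rw [Real.norm_of_nonneg (hk0 _)]; exact hkK _
  · filter_upwards [hν] with w hw
    have h1 : ContinuousAt k (z / w) := hkc.continuousAt (Ioi_mem_nhds (div_pos hz hw))
    exact ContinuousAt.comp (f := fun z => z / w) h1 (by fun_prop)

theorem measurable_integral_comp_div {k : ℝ → ℝ} (hk : Measurable k) (ν : Measure ℝ)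
    [SFinite ν] : Measurable fun z => ∫ w, k (z / w) ∂ν := by
  have h : StronglyMeasurable (Function.uncurry fun z w : ℝ => k (z / w)) :=
    (hk.comp (measurable_fst.div measurable_snd)).stronglyMeasurable
  exact h.integral_prod_right.measurable

/-! ### Mellin inversion and Parseval -/

/-- Mellin inversion for a law with continuous kernel. -/
theorem mellinInv_haarDensity {k : ℝ → ℝ} (hk : Measurable k) (hk0 : ∀ x, 0 ≤ k x)
    (hkc : ContinuousOn k (Set.Ioi 0)) {c : ℝ}
    (hc : Integrable (fun x : ℝ => (x : ℂ) ^ (c : ℂ)) (haarDensity k))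
    (hM : Integrable fun t : ℝ => ∫ x : ℝ, (x : ℂ) ^ (c + t * Complex.I : ℂ) ∂haarDensity k)
    {z : ℝ} (hz : 0 < z) :
    (k z : ℂ) = mellinInv c (fun s => ∫ x : ℝ, (x : ℂ) ^ s ∂haarDensity k) z := by
  have hmell : (fun s => ∫ x : ℝ, (x : ℂ) ^ s ∂haarDensity k) = mellin fun x => (k x : ℂ) := by
    ext s
    rw [integral_haarDensity hk fun x _ => hk0 x, mellin]
    refine setIntegral_congr_fun measurableSet_Ioi fun x hx => ?_
    have hx0 : (x : ℂ) ≠ 0 := Complex.ofReal_ne_zero.2 (ne_of_gt hx)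
    rw [Complex.cpow_sub _ _ hx0, Complex.cpow_one, smul_eq_mul]
    ring
  rw [hmell]
  refine (mellinInv_mellin_eq c (fun x => (k x : ℂ)) hz ?_ ?_ ?_).symm
  · rw [integrable_haarDensity_iff hk fun x _ => hk0 x] at hc
    refine IntegrableOn.congr_fun hc (fun x hx => ?_) measurableSet_Ioi
    have hx0 : (x : ℂ) ≠ 0 := Complex.ofReal_ne_zero.2 (ne_of_gt hx)
    beta_reduce
    rw [Complex.cpow_sub _ _ hx0, Complex.cpow_one, smul_eq_mul]
    ring
  · rw [← hmell]
    exact hM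
  · exact Complex.continuous_ofReal.continuousAt.comp (hkc.continuousAt (Ioi_mem_nhds hz))

/-- Parseval's formula for Mellin transforms: expectations in terms of complex moments. -/
theorem integral_haarDensity_eq_mellin {k : ℝ → ℝ} (hk : Measurable k) (hk0 : ∀ x, 0 ≤ k x)
    {c : ℝ} {M : ℂ → ℂ} (hM : Integrable fun t : ℝ => M (c + t * Complex.I))
    (hkM : ∀ z : ℝ, 0 < z → (k z : ℂ) = mellinInv c M z)
    {φ : ℝ → ℂ} (hφ : MellinConvergent φ (-c : ℂ)) :
    ∫ z, φ z ∂haarDensity k =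
      (1 / (2 * Real.pi)) * ∫ t : ℝ, M (c + t * Complex.I) * mellin φ (-(c + t * Complex.I)) := by
  set μ := (volume : Measure ℝ).restrict (Set.Ioi 0) with hμ
  have hsplit : ∀ z t : ℝ, 0 < z → (z : ℂ) ^ (-(c + t * Complex.I) - 1 : ℂ) =
      (z : ℂ) ^ ((-c : ℂ) - 1) * (z : ℂ) ^ (-(t * Complex.I) : ℂ) := by
    intro z t hz
    rw [← Complex.cpow_add _ _ (Complex.ofReal_ne_zero.2 hz.ne')]
    congr 1
    ring
  have hint : Integrable (Function.uncurry fun z t : ℝ =>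
      (z : ℂ) ^ (-(c + t * Complex.I) - 1 : ℂ) * φ z * M (c + t * Complex.I))
      (μ.prod volume) := by
    have h1 : Integrable (fun p : ℝ × ℝ => ((p.1 : ℂ) ^ ((-c : ℂ) - 1) • φ p.1) *
      M (c + p.2 * Complex.I)) (μ.prod volume) := Integrable.mul_prod hφ hM
    have hpos : ∀ᵐ p ∂μ.prod (volume : Measure ℝ), 0 < p.1 :=
      Measure.quasiMeasurePreserving_fst.ae (ae_restrict_mem measurableSet_Ioi)
    have hc : Measurable fun x : ℝ => (x : ℂ) := Complex.measurable_ofReal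
    -- The only coupling between z and t is the unimodular factor z^(-it); the rest is a product of
    -- integrable functions.
    refine (h1.bdd_mul (c := 1) (f := fun p : ℝ × ℝ => (p.1 : ℂ) ^ (-(p.2 * Complex.I) : ℂ))
      (Measurable.aestronglyMeasurable (by fun_prop)) ?_).congr ?_
    · filter_upwards [hpos] with p hp
      rw [Complex.norm_cpow_eq_rpow_re_of_pos hp]
      simp
    · filter_upwards [hpos] with p hp
      simp only [Function.uncurry_def]
      rw [hsplit _ _ hp, smul_eq_mul]
      ring
  rw [integral_haarDensity hk fun x _ => hk0 x]
  have h2 : ∀ z ∈ Set.Ioi (0 : ℝ), (z : ℂ)⁻¹ * (k z * φ z) = (1 / (2 * Real.pi) : ℂ) *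
      ∫ t : ℝ, (z : ℂ) ^ (-(c + t * Complex.I) - 1 : ℂ) * φ z * M (c + t * Complex.I) := by
    intro z hz
    have hz0 : (z : ℂ) ≠ 0 := Complex.ofReal_ne_zero.2 (ne_of_gt hz)
    rw [hkM z hz, mellinInv, Complex.real_smul]
    have : ∀ t : ℝ, (z : ℂ) ^ (-(c + t * Complex.I) - 1 : ℂ) * φ z * M (c + t * Complex.I) =
        (z : ℂ)⁻¹ * φ z * ((z : ℂ) ^ (-(c + t * Complex.I)) • M (c + t * Complex.I)) := by
      intro t
      rw [Complex.cpow_sub _ _ hz0, Complex.cpow_one, smul_eq_mul]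
      ring
    simp only [this]
    rw [integral_const_mul]
    push_cast
    ring
  rw [setIntegral_congr_fun measurableSet_Ioi h2, integral_const_mul, integral_integral_swap hint]
  congr 2
  ext t
  rw [integral_mul_const, mellin, mul_comm]
  rfl

/-! ### Branch-safe rules for complex powers -/

theorem Complex.ofReal_prod_cpow {ι : Type*} (S : Finset ι) {x : ι → ℝ} (hx : ∀ i, 0 < x i) (s : ℂ) :
    ((∏ i ∈ S, x i : ℝ) : ℂ) ^ s = ∏ i ∈ S, (x i : ℂ) ^ s := by
  classical
  induction S using Finset.induction_on with
  | empty => simp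
  | insert i S hi ih =>
    rw [Finset.prod_insert hi, Finset.prod_insert hi, Complex.ofReal_mul,
      Complex.mul_cpow_ofReal_nonneg (hx i).le (Finset.prod_nonneg fun j _ => (hx j).le), ih]

theorem Complex.mul_ofReal_cpow (w : ℂ) {x : ℝ} (hx : 0 < x) (s : ℂ) :
    (w * x) ^ s = w ^ s * (x : ℂ) ^ s := by
  have hx0 : (x : ℂ) ≠ 0 := Complex.ofReal_ne_zero.2 hx.ne'
  rcases eq_or_ne w 0 with rfl | hw
  · rcases eq_or_ne s 0 with rfl | hs
    · simp
    · simp [hs]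
  · rw [Complex.cpow_def_of_ne_zero (mul_ne_zero hw hx0), Complex.cpow_def_of_ne_zero hw,
      Complex.cpow_def_of_ne_zero hx0, Complex.log_mul_ofReal x hx w hw, ← Complex.exp_add,
      Complex.ofReal_log hx.le]
    ring_nf

theorem Complex.cpow_neg_ofReal {x : ℝ} (hx : 0 < x) (s : ℂ) :
    (x : ℂ) ^ (-s) = ((x⁻¹ : ℝ) : ℂ) ^ s := by
  rw [Complex.ofReal_inv, Complex.cpow_neg, Complex.inv_cpow]
  rw [Complex.arg_ofReal_of_nonneg hx.le]
  exact Real.pi_pos.ne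

/-! ### Moments of products, and their inversion -/

section Moments

variable {Ω : Type*} [MeasurableSpace Ω] {P : Measure Ω} {ι : Type*} [Fintype ι]

theorem hasLaw_haarDensity_pos {X : Ω → ℝ} {k : ℝ → ℝ} (hX : HasLaw X (haarDensity k) P) :
    ∀ᵐ ω ∂P, 0 < X ω :=
  (hX.ae_iff (p := fun x => 0 < x) (measurableSet_setOfPred.1 measurableSet_Ioi)).2
    (ae_pos_haarDensity k)

/-- A product of independent variables with continuous bounded kernels has a continuous kernel. -/
theorem exists_hasLaw_prod_haarDensity [IsProbabilityMeasure P] [Nonempty ι] {V : ι → Ω → ℝ}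
    {κ : ι → ℝ → ℝ} {K : ι → ℝ} (hκ : ∀ i, Measurable (κ i)) (hκ0 : ∀ i x, 0 ≤ κ i x)
    (hκK : ∀ i x, κ i x ≤ K i) (hκc : ∀ i, ContinuousOn (κ i) (Set.Ioi 0))
    (hV : ∀ i, HasLaw (V i) (haarDensity (κ i)) P) (hind : iIndepFun V P) :
    ∃ k : ℝ → ℝ, Measurable k ∧ (∀ x, 0 ≤ k x) ∧ ContinuousOn k (Set.Ioi 0) ∧
      HasLaw (fun ω => ∏ i, V i ω) (haarDensity k) P := by
  classical
  obtain ⟨i₀⟩ := ‹Nonempty ι›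
  -- Only the factor `i₀` supplies regularity. The law of W needs no density, so the empty product W
  -- = 1 is covered as well.
  set W : Ω → ℝ := ∏ j ∈ Finset.univ.erase i₀, V j with hW
  have hWm : AEMeasurable W P := Finset.aemeasurable_prod _ fun j _ => (hV j).aemeasurable
  have hWind : IndepFun (V i₀) W P :=
    (hind.indepFun_finsetProd_of_notMem₀ (fun i => (hV i).aemeasurable)
      (Finset.notMem_erase i₀ _)).symm
  have hWpos : ∀ᵐ ω ∂P, 0 < W ω := by
    filter_upwards [ae_all_iff.2 fun i => hasLaw_haarDensity_pos (hV i)] with ω hω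
    rw [hW, Finset.prod_apply]
    exact Finset.prod_pos fun j _ => hω j
  have hνpos : ∀ᵐ w ∂P.map W, 0 < w := (ae_map_iff hWm measurableSet_Ioi).2 hWpos
  have hWlaw : HasLaw W (P.map W) P := ⟨hWm, rfl⟩
  have : IsProbabilityMeasure (P.map W) := Measure.isProbabilityMeasure_map hWm
  have : IsProbabilityMeasure (haarDensity (κ i₀)) := (hV i₀).isProbabilityMeasure_iff.1 ‹_›
  have hprod := hWind.hasLaw_fun_mul (hV i₀) hWlaw
  rw [mconv_haarDensity (hκ i₀) (hκ0 i₀) (hκK i₀) _ hνpos] at hprod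
  refine ⟨_, measurable_integral_comp_div (hκ i₀) _, fun x => integral_nonneg fun w => hκ0 _ _,
    continuousOn_integral_comp_div (hκ i₀) (hκ0 i₀) (hκK i₀) (hκc i₀) _ hνpos, ?_⟩
  convert hprod using 2 with ω
  rw [hW, Finset.prod_apply, Finset.mul_prod_erase Finset.univ (fun i => V i ω) (Finset.mem_univ _)]

theorem integral_cpow_prod_haarDensity [IsProbabilityMeasure P] {V : ι → Ω → ℝ}
    {κ : ι → ℝ → ℝ} {k : ℝ → ℝ} (hV : ∀ i, HasLaw (V i) (haarDensity (κ i)) P)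
    (hind : iIndepFun V P) (hZ : HasLaw (fun ω => ∏ i, V i ω) (haarDensity k) P) {s : ℂ}
    (hs : ∀ i, Integrable (fun x : ℝ => (x : ℂ) ^ s) (haarDensity (κ i))) :
    Integrable (fun x : ℝ => (x : ℂ) ^ s) (haarDensity k) ∧
      ∫ x : ℝ, (x : ℂ) ^ s ∂haarDensity k = ∏ i, ∫ x : ℝ, (x : ℂ) ^ s ∂haarDensity (κ i) := by
  have hm : Measurable fun x : ℝ => (x : ℂ) ^ s := by
    have hc : Measurable fun x : ℝ => (x : ℂ) := Complex.measurable_ofReal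
    fun_prop
  have : ∀ i, IsProbabilityMeasure (haarDensity (κ i)) := fun i =>
    (hV i).isProbabilityMeasure_iff.1 ‹_›
  have hpi := hind.hasLaw_pi hV
  have hpos : ∀ᵐ v ∂Measure.pi fun i => haarDensity (κ i), ∀ i, 0 < v i :=
    ae_all_iff.2 fun i => (Measure.quasiMeasurePreserving_eval _ i).ae (ae_pos_haarDensity (κ i))
  have hmul : Measurable fun v : ι → ℝ => ∏ i, v i := by fun_prop
  have hlaw : (Measure.pi fun i => haarDensity (κ i)).map (fun v => ∏ i, v i) =
      haarDensity k := by
    rw [← hpi.map_eq, AEMeasurable.map_map_of_aemeasurable hmul.aemeasurable hpi.aemeasurable,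
      ← hZ.map_eq]
    rfl
  have hcongr : ∀ᵐ v ∂Measure.pi fun i => haarDensity (κ i),
      ∏ i, (v i : ℂ) ^ s = ((∏ i, v i : ℝ) : ℂ) ^ s := by
    filter_upwards [hpos] with v hv
    rw [Complex.ofReal_prod_cpow _ hv]
  constructor
  · rw [← hlaw, integrable_map_measure hm.aestronglyMeasurable hmul.aemeasurable]
    exact (Integrable.fintype_prod hs).congr hcongr
  · rw [← hlaw, integral_map hmul.aemeasurable hm.aestronglyMeasurable, ← integral_congr_ae hcongr,
      integral_fintype_prod_eq_prod (f := fun _ (x : ℝ) => (x : ℂ) ^ s)]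

theorem integral_cpow_haarDensity_inv {k : ℝ → ℝ} {s : ℂ}
    (hs : Integrable (fun x : ℝ => (x : ℂ) ^ (-s)) (haarDensity k)) :
    Integrable (fun x : ℝ => (x : ℂ) ^ s) (haarDensity fun x : ℝ => k x⁻¹) ∧
      ∫ x : ℝ, (x : ℂ) ^ s ∂(haarDensity fun x : ℝ => k x⁻¹) =
        ∫ x : ℝ, (x : ℂ) ^ (-s) ∂haarDensity k := by
  have hm : Measurable fun x : ℝ => (x : ℂ) ^ s := by
    have hc : Measurable fun x : ℝ => (x : ℂ) := Complex.measurable_ofReal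
    fun_prop
  have hcongr : ∀ᵐ x : ℝ ∂haarDensity k, (x : ℂ) ^ (-s) = ((x⁻¹ : ℝ) : ℂ) ^ s := by
    filter_upwards [ae_pos_haarDensity k] with x hx
    exact Complex.cpow_neg_ofReal hx s
  rw [← map_inv_haarDensity, integrable_map_measure hm.aestronglyMeasurable
    measurable_inv.aemeasurable, integral_map measurable_inv.aemeasurable hm.aestronglyMeasurable]
  exact ⟨hs.congr hcongr, (integral_congr_ae hcongr).symm⟩

/-- The Gamma factors of the complex moments of a product of Fisher-Snedecor variables. -/
noncomputable def gammaProd (a b : ι → ℝ) (s : ℂ) : ℂ :=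
  ∏ i, Complex.Gamma (a i + s) * Complex.Gamma (b i - s)

/-- One pair is integrable and the others are bounded by their values at t = 0; this is where at
least one variable is needed. -/
theorem integrable_gammaProd [Nonempty ι] {a b : ι → ℝ} {c : ℝ} (ha : ∀ i, -a i < c)
    (hb : ∀ i, c < b i) : Integrable fun t : ℝ => gammaProd a b (c + t * Complex.I) := by
  classical
  obtain ⟨i₀⟩ := ‹Nonempty ι›
  have hi : ∀ i, Integrable fun t : ℝ => Complex.Gamma (a i + (c + t * Complex.I)) *
      Complex.Gamma (b i - (c + t * Complex.I)) := fun i =>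
    integrable_Gamma_add_mul_Gamma_sub (by linarith [ha i]) (by linarith [hb i])
  have hbd : ∀ i (t : ℝ), ‖Complex.Gamma (a i + (c + t * Complex.I)) *
      Complex.Gamma (b i - (c + t * Complex.I))‖ ≤
      Real.Gamma (a i + c) * Real.Gamma (b i - c) := by
    intro i t
    have h1 := Complex.norm_Gamma_le_Gamma_re (s := a i + (c + t * Complex.I))
      (by simp; linarith [ha i])
    have h2 := Complex.norm_Gamma_le_Gamma_re (s := b i - (c + t * Complex.I))
      (by simp; linarith [hb i])
    rw [norm_mul]
    refine mul_le_mul (h1.trans_eq (by simp)) (h2.trans_eq (by simp)) (norm_nonneg _) ?_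
    exact (Real.Gamma_pos_of_pos (by linarith [ha i])).le
  unfold gammaProd
  simp_rw [← Finset.prod_erase_mul Finset.univ _ (Finset.mem_univ i₀)]
  refine (hi i₀).bdd_mul (c := ∏ i ∈ Finset.univ.erase i₀,
    (Real.Gamma (a i + c) * Real.Gamma (b i - c))) ?_ (.of_forall fun t => ?_)
  · exact Finset.aestronglyMeasurable_fun_prod _ fun i _ => (hi i).aestronglyMeasurable
  · rw [norm_prod]
    exact Finset.prod_le_prod (fun _ _ => norm_nonneg _) fun i _ => hbd i t

theorem integrable_gammaProd_mul_cpow [Nonempty ι] {a b : ι → ℝ} {c : ℝ} (ha : ∀ i, -a i < c)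
    (hb : ∀ i, c < b i) {x : ℝ} (hx : 0 < x) : Integrable fun t : ℝ =>
      gammaProd a b (c + t * Complex.I) * (x : ℂ) ^ (c + t * Complex.I : ℂ) := by
  refine (integrable_gammaProd ha hb).mul_bdd (c := x ^ c) ?_ (.of_forall fun t => ?_)
  · refine Measurable.aestronglyMeasurable ?_
    fun_prop
  · rw [Complex.norm_cpow_eq_rpow_re_of_pos hx]
    simp

theorem hasMellin_indicator_Ioc {z : ℝ} (hz : 0 < z) {s : ℂ} (hs : 0 < s.re) :
    HasMellin (Set.indicator (Set.Ioc 0 z) (fun _ => 1 : ℝ → ℂ)) s ((z : ℂ) ^ s / s) := by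
  have h := hasMellin_one_Ioc hs
  have hz' : 0 < z⁻¹ := inv_pos.2 hz
  have heq : Set.indicator (Set.Ioc 0 z) (fun _ => 1 : ℝ → ℂ) = fun t =>
      Set.indicator (Set.Ioc 0 1) (fun _ => 1 : ℝ → ℂ) (z⁻¹ * t) := by
    ext t
    simp only [Set.indicator_apply, Set.mem_Ioc, inv_mul_le_one₀ hz, mul_pos_iff_of_pos_left hz']
  rw [heq]
  refine ⟨(MellinConvergent.comp_mul_left hz').2 h.1, ?_⟩
  rw [mellin_comp_mul_left _ _ hz', h.2, smul_eq_mul, Complex.cpow_neg_ofReal hz', inv_inv,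
    mul_one_div]

/-- A kernel on `(0, ∞)` whose complex moments are `x₀ ^ s * gammaProd a b s / B` on the strip. -/
structure HasGammaMoments (k : ℝ → ℝ) (a b : ι → ℝ) (x₀ B : ℝ) : Prop where
  measurable : Measurable k
  nonneg : ∀ x, 0 ≤ k x
  continuousOn : ContinuousOn k (Set.Ioi 0)
  scale_pos : 0 < x₀
  moment : ∀ s : ℂ, (∀ i, -a i < s.re) → (∀ i, s.re < b i) →
    Integrable (fun x : ℝ => (x : ℂ) ^ s) (haarDensity k) ∧
      ∫ x : ℝ, (x : ℂ) ^ s ∂haarDensity k = (x₀ : ℂ) ^ s * gammaProd a b s / B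

namespace HasGammaMoments

variable {k : ℝ → ℝ} {a b : ι → ℝ} {x₀ B : ℝ} {c : ℝ}

theorem div_cpow (h : HasGammaMoments k a b x₀ B) {z : ℝ} (hz : 0 < z) (s : ℂ) :
    ((x₀ / z : ℝ) : ℂ) ^ s = (z : ℂ) ^ (-s) * (x₀ : ℂ) ^ s := by
  rw [div_eq_mul_inv, Complex.ofReal_mul, Complex.mul_cpow_ofReal_nonneg h.scale_pos.le
    (inv_nonneg.2 hz.le), Complex.cpow_neg_ofReal hz, mul_comm]

theorem one_div_mul_cpow (h : HasGammaMoments k a b x₀ B) (r s : ℂ) :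
    (1 / (r * x₀)) ^ s = (1 / r) ^ s * (x₀ : ℂ) ^ (-s) := by
  rw [Complex.cpow_neg_ofReal h.scale_pos, ← Complex.mul_ofReal_cpow _ (inv_pos.2 h.scale_pos),
    Complex.ofReal_inv, one_div_mul_eq_div, one_div, mul_inv, div_eq_mul_inv, mul_comm r⁻¹]

variable [Nonempty ι]

/-- The line may be any in the strip, so independence of the contour comes from inversion itself,
without shifting contours. -/
theorem kernel_eq (h : HasGammaMoments k a b x₀ B) (ha : ∀ i, -a i < c) (hb : ∀ i, c < b i)
    {z : ℝ} (hz : 0 < z) :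
    (k z : ℂ) = mellinInv c (fun s => (x₀ : ℂ) ^ s * gammaProd a b s / B) z := by
  have hmom : ∀ t : ℝ, ∫ x : ℝ, (x : ℂ) ^ (c + t * Complex.I : ℂ) ∂haarDensity k =
      (x₀ : ℂ) ^ (c + t * Complex.I : ℂ) * gammaProd a b (c + t * Complex.I) / B := fun t =>
    (h.moment _ (by simpa using ha) (by simpa using hb)).2
  rw [mellinInv_haarDensity h.measurable h.nonneg h.continuousOn (c := c)
    (h.moment c (by simpa using ha) (by simpa using hb)).1 ?_ hz, mellinInv, mellinInv]
  · simp only [hmom]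
  · simp only [hmom]
    refine ((integrable_gammaProd_mul_cpow ha hb h.scale_pos).div_const B).congr (.of_forall fun t => ?_)
    simp only [mul_comm]

theorem kernel_eq_integral (h : HasGammaMoments k a b x₀ B) (ha : ∀ i, -a i < c)
    (hb : ∀ i, c < b i) {z : ℝ} (hz : 0 < z) :
    (k z : ℂ) = 1 / B * (1 / (2 * Real.pi) * ∫ t : ℝ, gammaProd a b (c + t * Complex.I) *
      ((x₀ / z : ℝ) : ℂ) ^ (c + t * Complex.I : ℂ)) := by
  rw [h.kernel_eq ha hb hz, mellinInv, Complex.real_smul, mul_left_comm (1 / (B : ℂ))]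
  push_cast
  simp only [← integral_const_mul]
  refine integral_congr_ae (.of_forall fun t => ?_)
  beta_reduce
  rw [← Complex.ofReal_div, h.div_cpow hz, smul_eq_mul]
  ring

theorem integrable_vertical (h : HasGammaMoments k a b x₀ B) (ha : ∀ i, -a i < c)
    (hb : ∀ i, c < b i) : Integrable fun t : ℝ =>
      (x₀ : ℂ) ^ (c + t * Complex.I : ℂ) * gammaProd a b (c + t * Complex.I) / B :=
  ((integrable_gammaProd_mul_cpow ha hb h.scale_pos).div_const B).congr (.of_forall fun t => by
    simp only [mul_comm])

/-- Parseval with the indicator of (0,z]. Its Mellin transform is evaluated at -s, hence c < 0. -/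
theorem measureReal_Iic (h : HasGammaMoments k a b x₀ B) (ha : ∀ i, -a i < c)
    (hb : ∀ i, c < b i) (hc : c < 0) {z : ℝ} (hz : 0 < z) :
    ((haarDensity k).real (Set.Iic z) : ℂ) = 1 / B * (1 / (2 * Real.pi) * ∫ t : ℝ,
      gammaProd a b (c + t * Complex.I) * ((x₀ / z : ℝ) : ℂ) ^ (c + t * Complex.I : ℂ) *
        (-(c + t * Complex.I))⁻¹) := by
  have hset : (haarDensity k).real (Set.Iic z) = (haarDensity k).real (Set.Ioc 0 z) := by
    refine measureReal_congr ?_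
    filter_upwards [ae_pos_haarDensity k] with x hx
    exact propext ⟨fun h => ⟨hx, h⟩, fun h => h.2⟩
  have hP := integral_haarDensity_eq_mellin h.measurable h.nonneg (h.integrable_vertical ha hb)
    (fun z hz => h.kernel_eq ha hb hz)
    (hasMellin_indicator_Ioc hz (s := -c) (by simpa using hc)).1
  rw [integral_indicator measurableSet_Ioc] at hP
  rw [hset]
  rw [setIntegral_const, Complex.real_smul, mul_one] at hP
  rw [hP, mul_left_comm (1 / (B : ℂ))]
  simp only [← integral_const_mul]
  refine integral_congr_ae (.of_forall fun t => ?_)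
  beta_reduce
  rw [(hasMellin_indicator_Ioc hz (by simpa using hc)).2, h.div_cpow hz]
  ring

theorem integral_exp_neg (h : HasGammaMoments k a b x₀ B) (ha : ∀ i, c < a i)
    (hb : ∀ i, -b i < c) (hc : 0 < c) {r : ℂ} (hr : 0 < r.re) :
    (∫ z : ℝ, Complex.exp (-(r * z)) ∂haarDensity k) = 1 / B * (1 / (2 * Real.pi) * ∫ t : ℝ,
      gammaProd a b (-(c + t * Complex.I)) * Complex.Gamma (c + t * Complex.I) *
        (1 / (r * x₀)) ^ (c + t * Complex.I : ℂ)) := by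
  have ha' : ∀ i, -a i < -c := fun i => by linarith [ha i]
  have hb' : ∀ i, -c < b i := fun i => by linarith [hb i]
  have hP := integral_haarDensity_eq_mellin h.measurable h.nonneg (h.integrable_vertical ha' hb')
    (fun z hz => h.kernel_eq ha' hb' hz)
    (mellinConvergent_exp_neg_mul (a := -((-c : ℝ) : ℂ)) (by simpa using hc) hr)
  -- Parseval is applied on the line -c; replacing t by -t turns s into -s, as in the stated
  -- G-function.
  rw [hP, mul_left_comm (1 / (B : ℂ)), ← integral_neg_eq_self]
  simp only [← integral_const_mul]
  refine integral_congr_ae (.of_forall fun t => ?_)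
  beta_reduce
  have e1 : ((-c : ℝ) : ℂ) + ((-t : ℝ) : ℂ) * Complex.I = -(c + t * Complex.I) := by
    push_cast; ring
  rw [e1, neg_neg, mellin_exp_neg_mul (by simpa using hc) hr]
  rw [h.one_div_mul_cpow]
  ring

/-- For nonreal r the power (1/r)^s can grow exponentially along the line. Together with Γ(s) it is
the Mellin transform of e^(-rx), which is bounded by its value for the rate Re r at the point c. -/
theorem integrable_mgf_integrand (h : HasGammaMoments k a b x₀ B) (ha : ∀ i, c < a i)
    (hb : ∀ i, -b i < c) (hc : 0 < c) {r : ℂ} (hr : 0 < r.re) :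
    Integrable fun t : ℝ => gammaProd a b (-(c + t * Complex.I)) *
      Complex.Gamma (c + t * Complex.I) * (1 / (r * x₀)) ^ (c + t * Complex.I : ℂ) := by
  have hre : ∀ t : ℝ, ((c : ℂ) + t * Complex.I).re = c := fun t => by simp
  have hg := (integrable_gammaProd (a := a) (b := b) (c := -c) (fun i => by linarith [ha i])
    fun i => by linarith [hb i]).comp_neg
  have hr0 : r ≠ 0 := by
    rintro rfl
    simp at hr
  have hcont : Continuous fun t : ℝ => Complex.Gamma (c + t * Complex.I) *
      (1 / (r * x₀)) ^ (c + t * Complex.I : ℂ) := by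
    refine Continuous.mul (continuous_iff_continuousAt.2 fun t => ?_) ?_
    · exact ContinuousAt.comp (f := fun t : ℝ => (c : ℂ) + t * Complex.I)
        (Complex.continuousAt_Gamma_of_re_pos (by rwa [hre])) (by fun_prop)
    · refine Continuous.const_cpow (by fun_prop) (Or.inl ?_)
      exact one_div_ne_zero (mul_ne_zero hr0 (Complex.ofReal_ne_zero.2 h.scale_pos.ne'))
  refine (hg.mul_bdd (c := r.re ^ (-c) * Real.Gamma c * x₀ ^ (-c)) hcont.aestronglyMeasurable
    (.of_forall fun t => ?_)).congr (.of_forall fun t => ?_)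
  · have hm : ‖mellin (fun x : ℝ => Complex.exp (-(r * x))) (c + t * Complex.I)‖ ≤
        r.re ^ (-c) * Real.Gamma c := by
      rw [mellin, ← integral_rpow_mul_exp_neg_mul_eq hc hr]
      refine (norm_integral_le_integral_norm _).trans_eq ?_
      refine setIntegral_congr_fun measurableSet_Ioi fun x hx => ?_
      simp only [smul_eq_mul]
      rw [norm_cpow_mul_exp_neg hx, hre]
    rw [mellin_exp_neg_mul (by rwa [hre]) hr] at hm
    rw [h.one_div_mul_cpow, mul_left_comm, ← mul_assoc, norm_mul _ ((x₀ : ℂ) ^ _),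
      Complex.norm_cpow_eq_rpow_re_of_pos h.scale_pos, Complex.neg_re, hre]
    exact mul_le_mul_of_nonneg_right hm (Real.rpow_nonneg h.scale_pos.le _)
  · have e1 : ((-c : ℝ) : ℂ) + ((-t : ℝ) : ℂ) * Complex.I = -(c + t * Complex.I) := by
      push_cast; ring
    beta_reduce
    rw [e1]
    ring

end HasGammaMoments

end Moments

/-! ### The law of the ratio -/

theorem exists_hasGammaMoments {Ω : Type*} [MeasurableSpace Ω] (P : Measure Ω)
    [IsProbabilityMeasure P] {L₁ L₂ : ℕ} (hL : 0 < L₁ + L₂)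
    {g₁ m₁ ms₁ : Fin L₁ → ℝ} {g₂ m₂ ms₂ : Fin L₂ → ℝ}
    (hg₁ : ∀ i, 0 < g₁ i) (hm₁ : ∀ i, 0 < m₁ i) (hms₁ : ∀ i, 1 < ms₁ i)
    (hg₂ : ∀ j, 0 < g₂ j) (hm₂ : ∀ j, 0 < m₂ j) (hms₂ : ∀ j, 1 < ms₂ j)
    {X₁ : Fin L₁ → Ω → ℝ} {X₂ : Fin L₂ → Ω → ℝ}
    (hX₁ : ∀ i, HasLaw (X₁ i) (fisherMeasure (g₁ i) (m₁ i) (ms₁ i)) P)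
    (hX₂ : ∀ j, HasLaw (X₂ j) (fisherMeasure (g₂ j) (m₂ j) (ms₂ j)) P)
    (hindep : iIndepFun (Sum.elim X₁ X₂) P) :
    ∃ k : ℝ → ℝ, HasGammaMoments k (Sum.elim m₁ ms₂) (Sum.elim ms₁ m₂)
        ((∏ i, g₁ i) * coeffA m₂ ms₂ / ((∏ j, g₂ j) * coeffA m₁ ms₁))
        (coeffB m₁ ms₁ * coeffB m₂ ms₂) ∧
      HasLaw (ratioOfProducts X₁ X₂) (haarDensity k) P := by
  have : Nonempty (Fin L₁ ⊕ Fin L₂) := by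
    rcases Nat.eq_zero_or_pos L₁ with h | h
    · exact ⟨Sum.inr ⟨0, by omega⟩⟩
    · exact ⟨Sum.inl ⟨0, h⟩⟩
  have hs₁ : ∀ i, 0 < ms₁ i - 1 := fun i => by linarith [hms₁ i]
  have hs₂ : ∀ j, 0 < ms₂ j - 1 := fun j => by linarith [hms₂ j]
  have hs₁' : ∀ i, 0 < ms₁ i := fun i => by linarith [hms₁ i]
  have hs₂' : ∀ j, 0 < ms₂ j := fun j => by linarith [hms₂ j]
  set l₁ : Fin L₁ → ℝ := fun i => (ms₁ i - 1) * g₁ i / m₁ i with hl₁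
  set l₂ : Fin L₂ → ℝ := fun j => (ms₂ j - 1) * g₂ j / m₂ j with hl₂
  have hl₁0 : ∀ i, 0 < l₁ i := fun i => div_pos (mul_pos (hs₁ i) (hg₁ i)) (hm₁ i)
  have hl₂0 : ∀ j, 0 < l₂ j := fun j => div_pos (mul_pos (hs₂ j) (hg₂ j)) (hm₂ j)
  set κ : Fin L₁ ⊕ Fin L₂ → ℝ → ℝ := Sum.elim (fun i => fisherKernel (l₁ i) (m₁ i) (ms₁ i))
    (fun j x => fisherKernel (l₂ j) (m₂ j) (ms₂ j) x⁻¹) with hκ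
  -- Z is a single product over the disjoint union. Inverting a denominator exchanges its m and ms,
  -- whence the mixed parameter lists.
  set V : Fin L₁ ⊕ Fin L₂ → Ω → ℝ := Sum.elim X₁ (fun j ω => (X₂ j ω)⁻¹) with hVdef
  have hV : ∀ i, HasLaw (V i) (haarDensity (κ i)) P := by
    rintro (i | j)
    · have h := hX₁ i
      rwa [fisherMeasure_eq_haarDensity (hg₁ i) (hm₁ i) (hms₁ i)] at h
    · have h := hX₂ j
      rw [fisherMeasure_eq_haarDensity (hg₂ j) (hm₂ j) (hms₂ j)] at h
      have hinv : HasLaw (fun x : ℝ => x⁻¹)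
          (haarDensity fun x => fisherKernel (l₂ j) (m₂ j) (ms₂ j) x⁻¹)
          (haarDensity (fisherKernel (l₂ j) (m₂ j) (ms₂ j))) :=
        ⟨measurable_inv.aemeasurable, map_inv_haarDensity _⟩
      exact hinv.fun_comp h
  have hVind : iIndepFun V P := by
    have h := hindep.comp (Sum.elim (fun _ => id) (fun _ x => x⁻¹)) (by
      rintro (i | j)
      · exact measurable_id
      · exact measurable_inv)
    convert h using 1
    ext i ω
    rcases i with i | j <;> rfl
  obtain ⟨k, hk, hk0, hkc, hZ⟩ := exists_hasLaw_prod_haarDensity (V := V) (κ := κ)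
    (K := Sum.elim (fun i => Real.Gamma (m₁ i + ms₁ i) / (Real.Gamma (m₁ i) * Real.Gamma (ms₁ i)))
      (fun j => Real.Gamma (m₂ j + ms₂ j) / (Real.Gamma (m₂ j) * Real.Gamma (ms₂ j))))
    (by
      rintro (i | j)
      · exact measurable_fisherKernel _ _ _
      · exact (measurable_fisherKernel _ _ _).comp measurable_inv)
    (by
      rintro (i | j) x
      · exact fisherKernel_nonneg (hl₁0 i) (hm₁ i) (hs₁' i) x
      · exact fisherKernel_nonneg (hl₂0 j) (hm₂ j) (hs₂' j) x⁻¹)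
    (by
      rintro (i | j) x
      · exact fisherKernel_le (hl₁0 i) (hm₁ i) (hs₁' i) x
      · exact fisherKernel_le (hl₂0 j) (hm₂ j) (hs₂' j) x⁻¹)
    (by
      rintro (i | j)
      · exact continuousOn_fisherKernel (hl₁0 i)
      · exact (continuousOn_fisherKernel (hl₂0 j)).comp
          (continuousOn_inv₀.mono fun x hx => (ne_of_gt hx))
            fun x hx => Set.mem_Ioi.2 (inv_pos.2 (Set.mem_Ioi.1 hx)))
    hV hVind
  have hx₀ : (∏ i, g₁ i) * coeffA m₂ ms₂ / ((∏ j, g₂ j) * coeffA m₁ ms₁) =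
      (∏ i, l₁ i) * ∏ j, (l₂ j)⁻¹ := by
    simp only [hl₁, hl₂, coeffA, Finset.prod_inv_distrib, Finset.prod_div_distrib,
      Finset.prod_mul_distrib]
    have n1 := (Finset.prod_pos fun i (_ : i ∈ Finset.univ) => hg₁ i).ne'
    have n2 := (Finset.prod_pos fun i (_ : i ∈ Finset.univ) => hg₂ i).ne'
    have n3 := (Finset.prod_pos fun i (_ : i ∈ Finset.univ) => hm₁ i).ne'
    have n4 := (Finset.prod_pos fun i (_ : i ∈ Finset.univ) => hm₂ i).ne'
    have n5 := (Finset.prod_pos fun i (_ : i ∈ Finset.univ) => hs₁ i).ne'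
    have n6 := (Finset.prod_pos fun i (_ : i ∈ Finset.univ) => hs₂ i).ne'
    field_simp
  have hx₀pos : 0 < (∏ i, l₁ i) * ∏ j, (l₂ j)⁻¹ :=
    mul_pos (Finset.prod_pos fun i _ => hl₁0 i) (Finset.prod_pos fun j _ => inv_pos.2 (hl₂0 j))
  refine ⟨k, ⟨hk, hk0, hkc, hx₀ ▸ hx₀pos, fun s hs1 hs2 => ?_⟩, ?_⟩
  · have hmom : ∀ i, Integrable (fun x : ℝ => (x : ℂ) ^ s) (haarDensity (κ i)) ∧
        ∫ x : ℝ, (x : ℂ) ^ s ∂haarDensity (κ i) =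
        ((Sum.elim l₁ (fun j => (l₂ j)⁻¹) i : ℝ) : ℂ) ^ s *
        (Complex.Gamma (Sum.elim m₁ ms₂ i + s) * Complex.Gamma (Sum.elim ms₁ m₂ i - s)) /
        (Sum.elim (fun i => Real.Gamma (m₁ i) * Real.Gamma (ms₁ i))
          (fun j => Real.Gamma (m₂ j) * Real.Gamma (ms₂ j)) i : ℝ) := by
      rintro (i | j)
      · exact integral_cpow_haarDensity_fisherKernel (hl₁0 i) (hm₁ i) (hs₁' i)
          (hs1 (Sum.inl i)) (hs2 (Sum.inl i))
      · have e1 := hs1 (Sum.inr j)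
        have e2 := hs2 (Sum.inr j)
        simp only [Sum.elim_inr] at e1 e2
        have h := integral_cpow_haarDensity_fisherKernel (s := -s) (hl₂0 j) (hm₂ j) (hs₂' j)
          (by simp only [Complex.neg_re]; linarith) (by simp only [Complex.neg_re]; linarith)
        have h' := integral_cpow_haarDensity_inv h.1
        refine ⟨h'.1, ?_⟩
        simp only [hκ, Sum.elim_inr]
        rw [h'.2, h.2, Complex.cpow_neg_ofReal (hl₂0 j), sub_neg_eq_add, ← sub_eq_add_neg,
          mul_comm (Complex.Gamma _)]
    have h := integral_cpow_prod_haarDensity hV hVind hZ (s := s) fun i => (hmom i).1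
    refine ⟨h.1, ?_⟩
    rw [h.2, Finset.prod_congr rfl fun i _ => (hmom i).2, Finset.prod_div_distrib,
      Finset.prod_mul_distrib, ← Complex.ofReal_prod_cpow, ← Complex.ofReal_prod, hx₀]
    · simp only [gammaProd, Fintype.prod_sum_type, Sum.elim_inl, Sum.elim_inr, coeffB]
    · rintro (i | j)
      · exact hl₁0 i
      · exact inv_pos.2 (hl₂0 j)
  · convert hZ using 2 with ω
    simp only [ratioOfProducts, hVdef, Fintype.prod_sum_type, Sum.elim_inl, Sum.elim_inr,
      Finset.prod_inv_distrib, div_eq_mul_inv]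

/-! ### Translation into Meijer's G-function -/

theorem hasMeijerG_of_integral {m n p q : ℕ} {a : Fin p → ℂ} {b : Fin q → ℂ} {x w : ℂ}
    (hsep : ∃ c : ℝ, IsSeparatingLine m n p q a b c)
    (h : ∀ c : ℝ, IsSeparatingLine m n p q a b c →
      Integrable (fun t : ℝ => meijerIntegrand m n p q a b x (c + t * Complex.I)) ∧
      1 / (2 * Real.pi) * ∫ t : ℝ, meijerIntegrand m n p q a b x (c + t * Complex.I) = w) :
    HasMeijerG m n p q a b x w := by
  refine ⟨hsep, fun c hc => ⟨(h c hc).1, ?_⟩⟩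
  rw [integral_mul_const, ← (h c hc).2]
  have hpi : (Real.pi : ℂ) ≠ 0 := Complex.ofReal_ne_zero.2 Real.pi_ne_zero
  field_simp

theorem exists_pos_lt_of_finite {ι : Type*} [Finite ι] {a : ι → ℝ} (ha : ∀ i, 0 < a i) :
    ∃ ε : ℝ, 0 < ε ∧ ∀ i, ε < a i := by
  rcases isEmpty_or_nonempty ι with h | h
  · exact ⟨1, one_pos, fun i => isEmptyElim i⟩
  · obtain ⟨i₀, hi₀⟩ := Finite.exists_min a
    exact ⟨a i₀ / 2, half_pos (ha i₀), fun i => by linarith [hi₀ i, ha i₀]⟩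

section Meijer

variable {L₁ L₂ : ℕ} {m₁ ms₁ : Fin L₁ → ℝ} {m₂ ms₂ : Fin L₂ → ℝ}

/-- Pole separation is exactly the strip on which `HasGammaMoments.moment` applies. -/
theorem isSeparatingLine_density_iff {c : ℝ} :
    IsSeparatingLine (L₁ + L₂) (L₁ + L₂) (L₁ + L₂) (L₂ + L₁)
      (Fin.append (oneSubParams m₁) (oneSubParams ms₂)) (Fin.append (params m₂) (params ms₁)) c ↔
      (∀ i, -Sum.elim m₁ ms₂ i < c) ∧ ∀ i, c < Sum.elim ms₁ m₂ i := by
  have h1 : ∀ j : Fin (L₂ + L₁), (j : ℕ) < L₁ + L₂ := fun j => by omega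
  have h2 : ∀ j : Fin (L₁ + L₂), (j : ℕ) < L₁ + L₂ := fun j => j.2
  simp only [IsSeparatingLine, h1, h2, Fin.forall_fin_add, Sum.forall, Fin.append_left,
    Fin.append_right, params, oneSubParams, Sum.elim_inl, Sum.elim_inr, Complex.ofReal_re,
    Complex.sub_re, Complex.one_re, forall_const, sub_sub_cancel_left]
  tauto

/-- The extra lower parameter 0 adds c < 0; the extra upper parameter 1 sits in the denominator and
imposes nothing. -/
theorem isSeparatingLine_cdf_iff {c : ℝ} :
    IsSeparatingLine (L₁ + L₂ + 1) (L₁ + L₂) (L₁ + L₂ + 1) (L₂ + L₁ + 1)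
      (Fin.append (Fin.append (oneSubParams m₁) (oneSubParams ms₂)) ![1])
      (Fin.append (Fin.append (params m₂) (params ms₁)) ![0]) c ↔
      (∀ i, -Sum.elim m₁ ms₂ i < c) ∧ (∀ i, c < Sum.elim ms₁ m₂ i) ∧ c < 0 := by
  have h1 : ∀ j : Fin (L₂ + L₁ + 1), (j : ℕ) < L₁ + L₂ + 1 := fun j => by omega
  have h2 : ∀ i : Fin L₁, (i : ℕ) < L₁ + L₂ := fun i => by omega
  have h3 : ∀ j : Fin L₂, L₁ + (j : ℕ) < L₁ + L₂ := fun j => by omega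
  simp only [IsSeparatingLine, h1, h2, h3, Fin.forall_fin_add, Sum.forall, Fin.append_left,
    Fin.append_right, params, oneSubParams, Sum.elim_inl, Sum.elim_inr, Complex.ofReal_re,
    Complex.sub_re, Complex.one_re, forall_const, sub_sub_cancel_left, Fin.val_castAdd,
    Fin.val_natAdd, Fin.forall_fin_one, Matrix.cons_val_fin_one, Complex.zero_re]
  simp
  tauto

theorem isSeparatingLine_mgf_iff {c : ℝ} :
    IsSeparatingLine (L₁ + L₂) (L₁ + L₂ + 1) (L₂ + L₁ + 1) (L₁ + L₂)
      (Fin.cons 1 (Fin.append (oneSubParams m₂) (oneSubParams ms₁)))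
      (Fin.append (params m₁) (params ms₂)) c ↔
      (∀ i, c < Sum.elim m₁ ms₂ i) ∧ (∀ i, -Sum.elim ms₁ m₂ i < c) ∧ 0 < c := by
  have h1 : ∀ j : Fin (L₂ + L₁ + 1), (j : ℕ) < L₁ + L₂ + 1 := fun j => by omega
  have h2 : ∀ j : Fin (L₁ + L₂), (j : ℕ) < L₁ + L₂ := fun j => j.2
  simp only [IsSeparatingLine, h1, h2, Fin.forall_fin_succ, Fin.forall_fin_add, Sum.forall,
    Fin.append_left, Fin.append_right, params, oneSubParams, Sum.elim_inl, Sum.elim_inr,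
    Complex.ofReal_re, Complex.sub_re, Complex.one_re, forall_const, sub_sub_cancel_left,
    Fin.cons_zero, Fin.cons_succ, sub_self]
  tauto

theorem meijerIntegrand_density (x s : ℂ) :
    meijerIntegrand (L₁ + L₂) (L₁ + L₂) (L₁ + L₂) (L₂ + L₁)
      (Fin.append (oneSubParams m₁) (oneSubParams ms₂)) (Fin.append (params m₂) (params ms₁)) x s =
      gammaProd (Sum.elim m₁ ms₂) (Sum.elim ms₁ m₂) s * x ^ s := by
  have h1 : ∀ j : Fin (L₂ + L₁), (j : ℕ) < L₁ + L₂ := fun j => by omega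
  have h2 : ∀ j : Fin (L₁ + L₂), (j : ℕ) < L₁ + L₂ := fun j => j.2
  simp only [meijerIntegrand, h1, h2, if_true, Fin.prod_univ_add, Fin.append_left,
    Fin.append_right, params, oneSubParams, gammaProd, Fintype.prod_sum_type, Sum.elim_inl,
    Sum.elim_inr, Finset.prod_mul_distrib, sub_sub_cancel]
  ring

/-- The extra parameters contribute Γ(-s)/Γ(1-s), which is 1/(-s) by the functional equation. -/
theorem meijerIntegrand_cdf (x : ℂ) {s : ℂ} (hs : s.re < 0) :
    meijerIntegrand (L₁ + L₂ + 1) (L₁ + L₂) (L₁ + L₂ + 1) (L₂ + L₁ + 1)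
      (Fin.append (Fin.append (oneSubParams m₁) (oneSubParams ms₂)) ![1])
      (Fin.append (Fin.append (params m₂) (params ms₁)) ![0]) x s =
      gammaProd (Sum.elim m₁ ms₂) (Sum.elim ms₁ m₂) s * x ^ s * (-s)⁻¹ := by
  have h1 : ∀ j : Fin (L₂ + L₁ + 1), (j : ℕ) < L₁ + L₂ + 1 := fun j => by omega
  have h2 : ∀ i : Fin L₁, (i : ℕ) < L₁ + L₂ := fun i => by omega
  have h3 : ∀ j : Fin L₂, L₁ + (j : ℕ) < L₁ + L₂ := fun j => by omega
  have hs0 : -s ≠ 0 := fun h => by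
    rw [neg_eq_zero.1 h] at hs
    exact lt_irrefl _ hs
  have hG : Complex.Gamma (-s) ≠ 0 := Complex.Gamma_ne_zero_of_re_pos (by simpa using hs)
  have hq : Complex.Gamma (-s) * (Complex.Gamma (1 - s))⁻¹ = (-s)⁻¹ := by
    rw [show 1 - s = -s + 1 by ring, Complex.Gamma_add_one _ hs0]
    field_simp
  simp only [meijerIntegrand, h1, h2, h3, if_true, Fin.prod_univ_add, Fin.append_left,
    Fin.append_right, params, oneSubParams, gammaProd, Fintype.prod_sum_type, Sum.elim_inl,
    Sum.elim_inr, Finset.prod_mul_distrib, sub_sub_cancel, Fin.val_castAdd, Fin.val_natAdd,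
    Fin.prod_univ_one, Matrix.cons_val_fin_one, Fin.val_zero, add_zero, lt_irrefl, if_false,
    zero_sub]
  rw [← hq]
  ring

theorem meijerIntegrand_mgf (x s : ℂ) :
    meijerIntegrand (L₁ + L₂) (L₁ + L₂ + 1) (L₂ + L₁ + 1) (L₁ + L₂)
      (Fin.cons 1 (Fin.append (oneSubParams m₂) (oneSubParams ms₁)))
      (Fin.append (params m₁) (params ms₂)) x s =
      gammaProd (Sum.elim m₁ ms₂) (Sum.elim ms₁ m₂) (-s) * Complex.Gamma s * x ^ s := by
  have h1 : ∀ j : Fin (L₂ + L₁ + 1), (j : ℕ) < L₁ + L₂ + 1 := fun j => by omega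
  have h2 : ∀ j : Fin (L₁ + L₂), (j : ℕ) < L₁ + L₂ := fun j => j.2
  simp only [meijerIntegrand, h1, h2, if_true, Fin.prod_univ_succ, Fin.prod_univ_add,
    Fin.append_left, Fin.append_right, params, oneSubParams, gammaProd, Fintype.prod_sum_type,
    Sum.elim_inl, Sum.elim_inr, Finset.prod_mul_distrib, sub_sub_cancel, Fin.cons_zero,
    Fin.cons_succ, sub_self, zero_add, sub_neg_eq_add, ← sub_eq_add_neg]
  ring

end Meijer

/-! ### Density, distribution function and moment generating function -/

theorem proposition1 {Ω : Type*} [MeasurableSpace Ω] (P : Measure Ω) [IsProbabilityMeasure P]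
    (L₁ L₂ : ℕ) (hL : 0 < L₁ + L₂)
    (g₁ m₁ ms₁ : Fin L₁ → ℝ) (g₂ m₂ ms₂ : Fin L₂ → ℝ)
    (hg₁ : ∀ i, 0 < g₁ i) (hm₁ : ∀ i, 1 / 2 < m₁ i) (hms₁ : ∀ i, 1 < ms₁ i)
    (hg₂ : ∀ j, 0 < g₂ j) (hm₂ : ∀ j, 1 / 2 < m₂ j) (hms₂ : ∀ j, 1 < ms₂ j)
    (X₁ : Fin L₁ → Ω → ℝ) (X₂ : Fin L₂ → Ω → ℝ)
    (hX₁ : ∀ i, HasLaw (X₁ i) (fisherMeasure (g₁ i) (m₁ i) (ms₁ i)) P)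
    (hX₂ : ∀ j, HasLaw (X₂ j) (fisherMeasure (g₂ j) (m₂ j) (ms₂ j)) P)
    (hindep : iIndepFun (Sum.elim X₁ X₂) P) :
    -- the probability density function
    (∃ f : ℝ → ℝ, Measurable f ∧ (∀ z, 0 ≤ f z) ∧ (∀ z, z ≤ 0 → f z = 0) ∧
      HasLaw (ratioOfProducts X₁ X₂) (volume.withDensity fun z => ENNReal.ofReal (f z)) P ∧
      ∀ z : ℝ, 0 < z →
        MeijerGConverges (L₁ + L₂) (L₁ + L₂) (L₁ + L₂) (L₂ + L₁)
          (Fin.append (oneSubParams m₁) (oneSubParams ms₂))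
          (Fin.append (params m₂) (params ms₁))
          (((∏ i, g₁ i) * coeffA m₂ ms₂ / (z * (∏ j, g₂ j) * coeffA m₁ ms₁) : ℝ) : ℂ) ∧
        (f z : ℂ) = 1 / ((z : ℂ) * coeffB m₁ ms₁ * coeffB m₂ ms₂) *
          meijerG (L₁ + L₂) (L₁ + L₂) (L₁ + L₂) (L₂ + L₁)
            (Fin.append (oneSubParams m₁) (oneSubParams ms₂))
            (Fin.append (params m₂) (params ms₁))
            (((∏ i, g₁ i) * coeffA m₂ ms₂ / (z * (∏ j, g₂ j) * coeffA m₁ ms₁) : ℝ) : ℂ)) ∧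
    -- the cumulative distribution function
    (∀ z : ℝ, 0 < z →
      MeijerGConverges (L₁ + L₂ + 1) (L₁ + L₂) (L₁ + L₂ + 1) (L₂ + L₁ + 1)
        (Fin.append (Fin.append (oneSubParams m₁) (oneSubParams ms₂)) ![1])
        (Fin.append (Fin.append (params m₂) (params ms₁)) ![0])
        (((∏ i, g₁ i) * coeffA m₂ ms₂ / (z * (∏ j, g₂ j) * coeffA m₁ ms₁) : ℝ) : ℂ) ∧
      (P.real {ω | ratioOfProducts X₁ X₂ ω ≤ z} : ℂ) =
        1 / ((coeffB m₁ ms₁ : ℂ) * coeffB m₂ ms₂) *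
          meijerG (L₁ + L₂ + 1) (L₁ + L₂) (L₁ + L₂ + 1) (L₂ + L₁ + 1)
            (Fin.append (Fin.append (oneSubParams m₁) (oneSubParams ms₂)) ![1])
            (Fin.append (Fin.append (params m₂) (params ms₁)) ![0])
            (((∏ i, g₁ i) * coeffA m₂ ms₂ / (z * (∏ j, g₂ j) * coeffA m₁ ms₁) : ℝ) : ℂ)) ∧
    -- the moment generating function `s ↦ E[exp (-s Z)]`
    (∀ s : ℂ, 0 < s.re →
      Integrable (fun ω => Complex.exp (-(s * (ratioOfProducts X₁ X₂ ω : ℂ)))) P ∧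
      MeijerGConverges (L₁ + L₂) (L₁ + L₂ + 1) (L₂ + L₁ + 1) (L₁ + L₂)
        (Fin.cons 1 (Fin.append (oneSubParams m₂) (oneSubParams ms₁)))
        (Fin.append (params m₁) (params ms₂))
        ((((∏ j, g₂ j) * coeffA m₁ ms₁ : ℝ) : ℂ) /
          (s * (((∏ i, g₁ i) * coeffA m₂ ms₂ : ℝ) : ℂ))) ∧
      ∫ ω, Complex.exp (-(s * (ratioOfProducts X₁ X₂ ω : ℂ))) ∂P =
        1 / ((coeffB m₁ ms₁ : ℂ) * coeffB m₂ ms₂) *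
          meijerG (L₁ + L₂) (L₁ + L₂ + 1) (L₂ + L₁ + 1) (L₁ + L₂)
            (Fin.cons 1 (Fin.append (oneSubParams m₂) (oneSubParams ms₁)))
            (Fin.append (params m₁) (params ms₂))
            ((((∏ j, g₂ j) * coeffA m₁ ms₁ : ℝ) : ℂ) /
              (s * (((∏ i, g₁ i) * coeffA m₂ ms₂ : ℝ) : ℂ)))) := by
  obtain ⟨k, hk, hZ⟩ := exists_hasGammaMoments P hL hg₁ (fun i => by linarith [hm₁ i]) hms₁ hg₂
    (fun j => by linarith [hm₂ j]) hms₂ hX₁ hX₂ hindep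
  have : Nonempty (Fin L₁ ⊕ Fin L₂) := by
    rcases Nat.eq_zero_or_pos L₁ with h | h
    · exact ⟨Sum.inr ⟨0, by omega⟩⟩
    · exact ⟨Sum.inl ⟨0, h⟩⟩
  have ha : ∀ i, 0 < Sum.elim m₁ ms₂ i := by
    rintro (i | j)
    · exact (by norm_num : (0 : ℝ) < 1 / 2).trans (hm₁ i)
    · exact one_pos.trans (hms₂ j)
  have hb : ∀ i, 0 < Sum.elim ms₁ m₂ i := by
    rintro (i | j)
    · exact one_pos.trans (hms₁ i)
    · exact (by norm_num : (0 : ℝ) < 1 / 2).trans (hm₂ j)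
  -- Witness for the separating lines: -ε for the distribution function and ε for the generating
  -- function. The density can use c = 0.
  obtain ⟨ε, hε, hεa⟩ := exists_pos_lt_of_finite ha
  have hpos := hk.scale_pos
  have hx : ∀ z : ℝ, (∏ i, g₁ i) * coeffA m₂ ms₂ / (z * (∏ j, g₂ j) * coeffA m₁ ms₁) =
      (∏ i, g₁ i) * coeffA m₂ ms₂ / ((∏ j, g₂ j) * coeffA m₁ ms₁) / z := fun z => by
    rw [div_div, mul_comm _ z, ← mul_assoc z]
  have hxr : ∀ r : ℂ, (((∏ j, g₂ j) * coeffA m₁ ms₁ : ℝ) : ℂ) /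
      (r * (((∏ i, g₁ i) * coeffA m₂ ms₂ : ℝ) : ℂ)) =
      1 / (r * (((∏ i, g₁ i) * coeffA m₂ ms₂ / ((∏ j, g₂ j) * coeffA m₁ ms₁) : ℝ) : ℂ)) := by
    intro r
    rw [Complex.ofReal_div, ← mul_div_assoc, one_div_div]
  simp only [hx, hxr]
  set x₀ : ℝ := (∏ i, g₁ i) * coeffA m₂ ms₂ / ((∏ j, g₂ j) * coeffA m₁ ms₁)
  have hB : (coeffB m₁ ms₁ : ℂ) * coeffB m₂ ms₂ = ((coeffB m₁ ms₁ * coeffB m₂ ms₂ : ℝ) : ℂ) := by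
    push_cast
    rfl
  have hBne : ((coeffB m₁ ms₁ * coeffB m₂ ms₂ : ℝ) : ℂ) ≠ 0 := by
    refine Complex.ofReal_ne_zero.2 (mul_ne_zero ?_ ?_)
    · exact (Finset.prod_pos fun i _ => mul_pos (Real.Gamma_pos_of_pos (ha (Sum.inl i)))
        (Real.Gamma_pos_of_pos (hb (Sum.inl i)))).ne'
    · exact (Finset.prod_pos fun j _ => mul_pos (Real.Gamma_pos_of_pos (hb (Sum.inr j)))
        (Real.Gamma_pos_of_pos (ha (Sum.inr j)))).ne'
  set B : ℝ := coeffB m₁ ms₁ * coeffB m₂ ms₂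
  have hval : ∀ v I : ℂ, v = 1 / B * I → I = B * v := fun v I h => by
    rw [h]
    field_simp
  refine ⟨⟨fun z => if 0 < z then k z / z else 0, ?_, ?_, ?_, ?_, ?_⟩, ?_, ?_⟩
  · exact Measurable.ite measurableSet_Ioi (hk.measurable.div measurable_id) measurable_const
  · intro z
    beta_reduce
    split_ifs with h
    · exact div_nonneg (hk.nonneg z) h.le
    · rfl
  · exact fun z hz => if_neg hz.not_gt
  · have hdens : haarDensity k =
        volume.withDensity fun z => ENNReal.ofReal (if 0 < z then k z / z else 0) := by
      rw [haarDensity, ← withDensity_indicator measurableSet_Ioi]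
      congr 1
      ext1 z
      by_cases hz : 0 < z
      · rw [Set.indicator_of_mem (by exact hz), if_pos hz]
      · rw [Set.indicator_of_notMem (by exact hz), if_neg hz, ENNReal.ofReal_zero]
    exact hdens ▸ hZ
  · intro z hz
    have h : HasMeijerG (L₁ + L₂) (L₁ + L₂) (L₁ + L₂) (L₂ + L₁)
        (Fin.append (oneSubParams m₁) (oneSubParams ms₂))
        (Fin.append (params m₂) (params ms₁)) ((x₀ / z : ℝ) : ℂ) (B * k z) := by
      refine hasMeijerG_of_integral
        ⟨0, isSeparatingLine_density_iff.2 ⟨fun i => neg_lt_zero.2 (ha i), hb⟩⟩ fun c hc => ?_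
      obtain ⟨hc1, hc2⟩ := isSeparatingLine_density_iff.1 hc
      simp only [meijerIntegrand_density]
      exact ⟨integrable_gammaProd_mul_cpow hc1 hc2 (div_pos hpos hz),
        hval _ _ (hk.kernel_eq_integral hc1 hc2 hz)⟩
    refine ⟨⟨_, h⟩, ?_⟩
    have hz0 : (z : ℂ) ≠ 0 := Complex.ofReal_ne_zero.2 hz.ne'
    beta_reduce
    rw [h.meijerG_eq, mul_assoc (z : ℂ), hB, if_pos hz, Complex.ofReal_div]
    field_simp
  · intro z hz
    have hP : P.real {ω | ratioOfProducts X₁ X₂ ω ≤ z} = (haarDensity k).real (Set.Iic z) :=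
      hZ.measureReal_eq measurableSet_Iic
    have h : HasMeijerG (L₁ + L₂ + 1) (L₁ + L₂) (L₁ + L₂ + 1) (L₂ + L₁ + 1)
        (Fin.append (Fin.append (oneSubParams m₁) (oneSubParams ms₂)) ![1])
        (Fin.append (Fin.append (params m₂) (params ms₁)) ![0]) ((x₀ / z : ℝ) : ℂ)
        (B * (haarDensity k).real (Set.Iic z)) := by
      refine hasMeijerG_of_integral ⟨-ε, isSeparatingLine_cdf_iff.2 ⟨fun i => neg_lt_neg (hεa i),
        fun i => (neg_lt_zero.2 hε).trans (hb i), neg_lt_zero.2 hε⟩⟩ fun c hc => ?_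
      obtain ⟨hc1, hc2, hc3⟩ := isSeparatingLine_cdf_iff.1 hc
      have hre : ∀ t : ℝ, ((c : ℂ) + t * Complex.I).re = c := fun t => by simp
      simp only [fun t : ℝ => meijerIntegrand_cdf (m₁ := m₁) (ms₁ := ms₁) (m₂ := m₂) (ms₂ := ms₂)
        ((x₀ / z : ℝ) : ℂ) (s := c + t * Complex.I) (by rwa [hre])]
      refine ⟨?_, hval _ _ (hk.measureReal_Iic hc1 hc2 hc3 hz)⟩
      -- The extra factor 1/(-s) is bounded by 1/|c|, since |s| ≥ |Re s| = |c| > 0.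
      refine (integrable_gammaProd_mul_cpow hc1 hc2 (div_pos hpos hz)).mul_bdd (c := |c|⁻¹)
        (Measurable.aestronglyMeasurable (by fun_prop)) (.of_forall fun t => ?_)
      rw [norm_inv, norm_neg]
      refine inv_anti₀ (abs_pos.2 hc3.ne) ?_
      simpa only [hre] using Complex.abs_re_le_norm ((c : ℂ) + t * Complex.I)
    refine ⟨⟨_, h⟩, ?_⟩
    rw [h.meijerG_eq, hB, hP]
    field_simp
  · intro r hr
    have hr0 : r ≠ 0 := by
      rintro rfl
      simp at hr
    have hmeas : Measurable fun x : ℝ => Complex.exp (-(r * x)) := by fun_prop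
    have hexp : ∫ ω, Complex.exp (-(r * (ratioOfProducts X₁ X₂ ω : ℂ))) ∂P =
        ∫ x : ℝ, Complex.exp (-(r * x)) ∂haarDensity k :=
      hZ.integral_comp (f := fun x : ℝ => Complex.exp (-(r * x))) hmeas.aestronglyMeasurable
    have h : HasMeijerG (L₁ + L₂) (L₁ + L₂ + 1) (L₂ + L₁ + 1) (L₁ + L₂)
        (Fin.cons 1 (Fin.append (oneSubParams m₂) (oneSubParams ms₁)))
        (Fin.append (params m₁) (params ms₂)) (1 / (r * (x₀ : ℂ)))
        (B * ∫ x : ℝ, Complex.exp (-(r * x)) ∂haarDensity k) := by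
      refine hasMeijerG_of_integral ⟨ε, isSeparatingLine_mgf_iff.2 ⟨hεa,
        fun i => (neg_lt_zero.2 (hb i)).trans hε, hε⟩⟩ fun c hc => ?_
      obtain ⟨hc1, hc2, hc3⟩ := isSeparatingLine_mgf_iff.1 hc
      simp only [meijerIntegrand_mgf]
      exact ⟨hk.integrable_mgf_integrand hc1 hc2 hc3 hr,
        hval _ _ (hk.integral_exp_neg hc1 hc2 hc3 hr)⟩
    refine ⟨?_, ⟨_, h⟩, ?_⟩
    · refine Integrable.mono' (integrable_const (1 : ℝ))
        (hmeas.comp_aemeasurable hZ.aemeasurable).aestronglyMeasurable ?_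
      filter_upwards [hasLaw_haarDensity_pos hZ] with ω hω
      rw [Complex.norm_exp]
      simpa using mul_nonneg hr.le hω.le
    · rw [h.meijerG_eq, hB, hexp]
      field_simp
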